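/- Let $A$ be a commutative ring and let $\mathcal B$ be an $A$-linear abelian category. Let $F\mathcal B$ be the category of finitely filtered objects of $\mathcal B$: its objects are pairs $(V, W_\bullet V)$, where $V\in\mathcal B$ and $W_\bullet V$ is an increasing filtration of $V$ by subobjects indexed by $\mathbb Z$, with $W_iV=V$ and $W_{-i}V=0$ for all sufficiently large $i$; its morphisms are the morphisms $f\colon V\to V'$ of $\mathcal B$ that carry $W_iV$ into $W_iV'$ for every $i$. Endow $F\mathcal B$ with the exact structure in which a sequence $0\to V^0\to V^1\to V^2\to 0$ is exact if, for every $i$, the sequence $0\to \mathrm{Gr}^i_WV^0\to \mathrm{Gr}^i_WV^1\to \mathrm{Gr}^i_WV^2\to 0$, with $\mathrm{Gr}^i_W=W_i/W_{i-1}$, is split exact. Let $D^b(F\mathcal B)$ be the bounded derived category of this exact category (the Verdier quotient of the bounded homotopy category of $F\mathcal B$ by the acyclic complexes), let $D^b(\mathcal B)$ be the bounded derived category of $\mathcal B$, and let $\Phi\colon D^b(F\mathcal B)\to D^b(\mathcal B)$ be the functor induced by forgetting the filtrations. For $V\in\mathcal B$ and $i\in\mathbb Z$ let $V\{i\}$ be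 the object of $F\mathcal B$ with underlying object $V$ and with $W_jV\{i\}=V$ for $j\ge -i$ and $W_jV\{i\}=0$ for $j<-i$. Then, for all $V,V'\in\mathcal B$ and all integers $i,j,n$: 1. if $n\le j-i$, the functor $\Phi$ induces an isomorphism of $A$-modules $$\mathrm{Hom}_{D^b(F\mathcal B)}(V\{i\},V'\{j\}[n])\;\xrightarrow{\ \sim\ }\;\mathrm{Hom}_{D^b(\mathcal B)}(V,V'[n]);$$ 2. if $n>j-i$, then $\mathrm{Hom}_{D^b(F\mathcal B)}(V\{i\},V'\{j\}[n])=0$. -/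

import Mathlib

open CategoryTheory Category Limits ZeroObject Pretriangulated

universe t w v u v' u'

/-- An object of `B` with a finite increasing filtration indexed by `ℤ`. -/
structure FilteredObject (B : Type u) [Category.{v} B] [Abelian B] where
  /-- the underlying object -/
  obj : B
  /-- the steps of the filtration -/
  W : ℤ → Subobject obj
  monotone : Monotone W
  finite : ∃ N : ℤ, ∀ i : ℤ, N ≤ i → W i = ⊤ ∧ W (-i) = ⊥

namespace FilteredObject

variable {B : Type u} [Category.{v} B] [Abelian B]

/-- A morphism of filtered objects: a morphism `f` of the underlying objects that carries
`W i` into `W i`, i.e. such that `W i ⟶ X.obj ⟶ Y.obj` factors through `Y.W i`. -/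
@[ext]
structure Hom (X Y : FilteredObject B) where
  /-- the underlying morphism -/
  f : X.obj ⟶ Y.obj
  factors : ∀ i, (Y.W i).Factors ((X.W i).arrow ≫ f)

lemma factors_comp {X Y Z : FilteredObject B} {f : X.obj ⟶ Y.obj} {g : Y.obj ⟶ Z.obj} {i : ℤ}
    (hf : (Y.W i).Factors ((X.W i).arrow ≫ f)) (hg : (Z.W i).Factors ((Y.W i).arrow ≫ g)) :
    (Z.W i).Factors ((X.W i).arrow ≫ f ≫ g) := by
  rw [← assoc, ← Subobject.factorThru_arrow _ _ hf, assoc]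
  exact Subobject.factors_of_factors_right _ hg

instance : Category (FilteredObject B) where
  Hom := Hom
  id X := ⟨𝟙 _, fun i => by simpa using Subobject.factors_self _⟩
  comp f g := ⟨f.f ≫ g.f, fun i => factors_comp (f.factors i) (g.factors i)⟩

@[ext]
lemma hom_ext {X Y : FilteredObject B} {f g : X ⟶ Y} (h : f.f = g.f) : f = g := Hom.ext h

@[simp] lemma id_f (X : FilteredObject B) : Hom.f (𝟙 X) = 𝟙 X.obj := rfl

@[simp] lemma comp_f {X Y Z : FilteredObject B} (f : X ⟶ Y) (g : Y ⟶ Z) :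
    (f ≫ g).f = f.f ≫ g.f := rfl

lemma factors_neg {X Y : B} {P : Subobject Y} {f : X ⟶ Y} (h : P.Factors f) :
    P.Factors (-f) := by
  rw [← Subobject.factorThru_arrow P f h, ← Preadditive.neg_comp]
  exact Subobject.factors_comp_arrow _

section
variable {X Y : FilteredObject B}

instance : Zero (X ⟶ Y) := ⟨⟨0, fun i => by rw [comp_zero]; exact Subobject.factors_zero⟩⟩
instance : Add (X ⟶ Y) := ⟨fun f g => ⟨f.f + g.f, fun i => by
  rw [Preadditive.comp_add]; exact Subobject.factors_add _ _ (f.factors i) (g.factors i)⟩⟩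
instance : Neg (X ⟶ Y) := ⟨fun f => ⟨-f.f, fun i => by
  rw [Preadditive.comp_neg]; exact factors_neg (f.factors i)⟩⟩

@[simp] lemma zero_f : Hom.f (0 : X ⟶ Y) = 0 := rfl
@[simp] lemma add_f (f g : X ⟶ Y) : (f + g).f = f.f + g.f := rfl
@[simp] lemma neg_f (f : X ⟶ Y) : (-f).f = -f.f := rfl

instance : AddCommGroup (X ⟶ Y) where
  add_assoc f g h := by ext; simp [add_assoc]
  zero_add f := by ext; simp
  add_zero f := by ext; simp
  add_comm f g := by ext; simp [add_comm]
  neg_add_cancel f := by ext; simp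
  nsmul := nsmulRec
  zsmul := zsmulRec

end

instance : Preadditive (FilteredObject B) where
  add_comp _ _ _ f f' g := by ext; simp
  comp_add _ _ _ f g g' := by ext; simp

section
variable {A : Type t} [CommRing A] [Linear A B] {X Y : FilteredObject B}

instance : SMul A (X ⟶ Y) := ⟨fun a f => ⟨a • f.f, fun i => by
  rw [Linear.comp_smul, ← Subobject.factorThru_arrow _ _ (f.factors i), ← Linear.smul_comp]
  exact Subobject.factors_comp_arrow _⟩⟩

@[simp] lemma smul_f (a : A) (f : X ⟶ Y) : (a • f).f = a • f.f := rfl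

instance : Module A (X ⟶ Y) where
  one_smul f := by ext; simp
  mul_smul a b f := by ext; simp [mul_smul]
  smul_zero a := by ext; simp
  smul_add a f g := by ext; simp
  add_smul a b f := by ext; simp [add_smul]
  zero_smul f := by ext; simp

instance : Linear A (FilteredObject B) where
  smul_comp _ _ _ a f g := by ext; simp
  comp_smul _ _ _ f a g := by ext; simp

end

variable (B) in
/-- The functor forgetting the filtration. -/
@[simps]
def forget : FilteredObject B ⥤ B where
  obj X := X.obj
  map f := f.f

instance : (forget B).Additive where

instance {A : Type t} [CommRing A] [Linear A B] : (forget B).Linear A where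

instance : HasZeroObject (FilteredObject B) where
  zero := ⟨⟨(0 : B), fun _ => ⊤, fun _ _ _ => le_rfl, 0, fun i _ => ⟨rfl, by
      rw [eq_comm, ← top_le_iff]
      exact Subobject.le_of_comm 0 (by apply (isZero_zero B).eq_of_tgt)⟩⟩, by
    rw [IsZero.iff_id_eq_zero]; exact hom_ext ((isZero_zero B).eq_of_tgt _ _)⟩

lemma eq_bot_of_arrow {X : B} {P : Subobject X} (h : P.arrow = 0) : P = ⊥ := by
  rw [← le_bot_iff]
  exact Subobject.le_of_comm 0 (by rw [zero_comp, h])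

lemma inf_pullback_factors_iff {X Y T : B} (P : Subobject X) (Q : Subobject Y) (f : T ⟶ X ⊞ Y) :
    ((Subobject.pullback biprod.fst).obj P ⊓ (Subobject.pullback biprod.snd).obj Q).Factors f ↔
      P.Factors (f ≫ biprod.fst) ∧ Q.Factors (f ≫ biprod.snd) := by
  rw [Subobject.inf_factors, pullback_factors_iff, pullback_factors_iff]

lemma factors_inl {X Y : B} (P : Subobject X) (Q : Subobject Y) :
    ((Subobject.pullback biprod.fst).obj P ⊓ (Subobject.pullback biprod.snd).obj Q).Factors
      (P.arrow ≫ (biprod.inl : X ⟶ X ⊞ Y)) :=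
  (inf_pullback_factors_iff _ _ _).2
    ⟨by rw [assoc, biprod.inl_fst, comp_id]; exact Subobject.factors_self _,
      by rw [assoc, biprod.inl_snd, comp_zero]; exact Subobject.factors_zero⟩

lemma factors_inr {X Y : B} (P : Subobject X) (Q : Subobject Y) :
    ((Subobject.pullback biprod.fst).obj P ⊓ (Subobject.pullback biprod.snd).obj Q).Factors
      (Q.arrow ≫ (biprod.inr : Y ⟶ X ⊞ Y)) :=
  (inf_pullback_factors_iff _ _ _).2
    ⟨by rw [assoc, biprod.inr_fst, comp_zero]; exact Subobject.factors_zero,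
      by rw [assoc, biprod.inr_snd, comp_id]; exact Subobject.factors_self _⟩

/-- The direct sum of two filtered objects, with `W i (X ⊞ Y) = W i X ⊞ W i Y`, written as
the intersection of the preimages of `W i X` and of `W i Y`. -/
noncomputable def sum (X Y : FilteredObject B) : FilteredObject B where
  obj := X.obj ⊞ Y.obj
  W i := (Subobject.pullback biprod.fst).obj (X.W i) ⊓ (Subobject.pullback biprod.snd).obj (Y.W i)
  monotone _ _ h := inf_le_inf ((Subobject.pullback _).monotone (X.monotone h))
    ((Subobject.pullback _).monotone (Y.monotone h))
  finite := by
    obtain ⟨N, hN⟩ := X.finite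
    obtain ⟨M, hM⟩ := Y.finite
    refine ⟨max N M, fun i hi => ?_⟩
    rw [(hN i (by lia)).1, (hM i (by lia)).1, (hN i (by lia)).2, (hM i (by lia)).2]
    refine ⟨by simp [Subobject.pullback_top], eq_bot_of_arrow ?_⟩
    have h := (inf_pullback_factors_iff (⊥ : Subobject X.obj) (⊥ : Subobject Y.obj) _).1
      (Subobject.factors_self _)
    rw [Subobject.bot_factors_iff_zero, Subobject.bot_factors_iff_zero] at h
    apply biprod.hom_ext
    · rw [h.1, zero_comp]
    · rw [h.2, zero_comp]

lemma sum_factors_iff {X Y : FilteredObject B} {T : B} (i : ℤ) (f : T ⟶ X.obj ⊞ Y.obj) :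
    ((sum X Y).W i).Factors f ↔
      (X.W i).Factors (f ≫ biprod.fst) ∧ (Y.W i).Factors (f ≫ biprod.snd) :=
  inf_pullback_factors_iff _ _ _

/-- The direct sum of two filtered objects together with its projections and inclusions. -/
@[simps]
noncomputable def sumBicone (X Y : FilteredObject B) : BinaryBicone X Y where
  pt := sum X Y
  fst := ⟨biprod.fst, fun i => ((sum_factors_iff i _).1 (Subobject.factors_self _)).1⟩
  snd := ⟨biprod.snd, fun i => ((sum_factors_iff i _).1 (Subobject.factors_self _)).2⟩
  inl := ⟨biprod.inl, fun _ => factors_inl _ _⟩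
  inr := ⟨biprod.inr, fun _ => factors_inr _ _⟩
  inl_fst := hom_ext biprod.inl_fst
  inl_snd := hom_ext biprod.inl_snd
  inr_fst := hom_ext biprod.inr_fst
  inr_snd := hom_ext biprod.inr_snd

instance : HasBinaryBiproducts (FilteredObject B) where
  has_binary_biproduct X Y := HasBinaryBiproduct.mk
    { bicone := sumBicone X Y
      isBilimit := isBinaryBilimitOfTotal _ (hom_ext (biprod.total (X := X.obj) (Y := Y.obj))) }

/-- The object `V{i}`: the filtration jumps only once, `W j = V` for `-i ≤ j`
and `W j = 0` for `j < -i`. -/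
noncomputable def single (i : ℤ) (V : B) : FilteredObject B where
  obj := V
  W j := if -i ≤ j then ⊤ else ⊥
  monotone j k h := by
    dsimp only
    split_ifs
    · exact le_rfl
    · lia
    · exact bot_le
    · exact le_rfl
  finite := ⟨|i| + 1, fun j hj => ⟨if_pos (by grind), if_neg (by grind)⟩⟩

variable (B) in
/-- The functor sending a filtered object to the step `W i` of its filtration. -/
noncomputable def step (i : ℤ) : FilteredObject B ⥤ B where
  obj X := (X.W i : B)
  map {X Y} f := (Y.W i).factorThru ((X.W i).arrow ≫ f.f) (f.factors i)
  map_id X := by rw [← cancel_mono (X.W i).arrow]; simp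
  map_comp {X Y Z} f g := by rw [← cancel_mono (Z.W i).arrow]; simp

variable (B) in
/-- The inclusion of `W i` into the underlying object. -/
noncomputable def stepArrow (i : ℤ) : step B i ⟶ forget B where
  app X := (X.W i).arrow
  naturality _ _ f := Subobject.factorThru_arrow _ _ (f.factors i)

instance (i : ℤ) (X : FilteredObject B) : Mono ((stepArrow B i).app X) :=
  inferInstanceAs (Mono (X.W i).arrow)

instance (i : ℤ) : (step B i).Additive where
  map_add {X Y f g} := by
    rw [← cancel_mono ((stepArrow B i).app Y), Preadditive.add_comp]
    simp only [NatTrans.naturality, Functor.map_add, Preadditive.comp_add]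

/-- The inclusion of `W (i - 1)` into `W i`, on objects. -/
noncomputable def stepInclApp (i : ℤ) (X : FilteredObject B) :
    (step B (i - 1)).obj X ⟶ (step B i).obj X :=
  Subobject.ofLE _ _ (X.monotone (by lia))

lemma stepInclApp_arrow (i : ℤ) (X : FilteredObject B) :
    stepInclApp i X ≫ (stepArrow B i).app X = (stepArrow B (i - 1)).app X :=
  Subobject.ofLE_arrow _

variable (B) in
/-- The inclusion of `W (i - 1)` into `W i`. -/
noncomputable def stepIncl (i : ℤ) : step B (i - 1) ⟶ step B i where
  app X := stepInclApp i X
  naturality X Y f := by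
    rw [← cancel_mono ((stepArrow B i).app Y), assoc, assoc, stepInclApp_arrow,
      NatTrans.naturality, NatTrans.naturality, ← stepInclApp_arrow i X, assoc]

instance (i : ℤ) (X : FilteredObject B) : Mono ((stepIncl B i).app X) :=
  mono_of_mono_fac (stepInclApp_arrow i X)

variable (B) in
/-- The functor `Gr i`, sending a filtered object to `W i / W (i - 1)`. -/
noncomputable def gr (i : ℤ) : FilteredObject B ⥤ B where
  obj X := cokernel ((stepIncl B i).app X)
  map f := cokernel.map _ _ ((step B (i - 1)).map f) ((step B i).map f)
    ((stepIncl B i).naturality f).symm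
  map_id X := by
    rw [← cancel_epi (cokernel.π _), cokernel.π_desc, CategoryTheory.Functor.map_id, id_comp, comp_id]
  map_comp f g := by
    rw [← cancel_epi (cokernel.π _), cokernel.π_desc, cokernel.π_desc_assoc, assoc,
      cokernel.π_desc, Functor.map_comp, assoc]

variable (B) in
/-- The projection of `W i` onto `Gr i`. -/
noncomputable def stepProj (i : ℤ) : step B i ⟶ gr B i where
  app X := cokernel.π ((stepIncl B i).app X)
  naturality _ _ _ := (cokernel.π_desc _ _ _).symm

lemma stepIncl_stepProj (i : ℤ) (X : FilteredObject B) :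
    (stepIncl B i).app X ≫ (stepProj B i).app X = 0 := cokernel.condition _

instance (i : ℤ) (X : FilteredObject B) : Epi ((stepProj B i).app X) :=
  inferInstanceAs (Epi (cokernel.π ((stepIncl B i).app X)))

instance (i : ℤ) : (gr B i).Additive where
  map_add {X Y f g} := by
    rw [← cancel_epi ((stepProj B i).app X), Preadditive.comp_add]
    simp only [← NatTrans.naturality, Functor.map_add, Preadditive.add_comp]

variable (B) in
/-- The exact structure on filtered objects: a sequence `0 ⟶ X ⟶ Y ⟶ Z ⟶ 0` is exact if
`0 ⟶ Gr i X ⟶ Gr i Y ⟶ Gr i Z ⟶ 0` is a split exact sequence for every `i`. -/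
def exactStructure : ObjectProperty (ShortComplex (FilteredObject B)) :=
  fun S => ∀ i : ℤ, Nonempty (S.map (gr B i)).Splitting

lemma step_shortExact (i : ℤ) (X : FilteredObject B) :
    (ShortComplex.mk _ _ (stepIncl_stepProj i X)).ShortExact where
  exact := ShortComplex.exact_cokernel _

end FilteredObject

section
variable {C : Type u'} [Category.{v'} C] [Preadditive C]

/-- A cochain complex `K` is acyclic with respect to a class `E` of short exact sequences if
its differentials `K n ⟶ K (n + 1)` factor as `K n ⟶ Z (n + 1) ⟶ K (n + 1)` in such a way that all
the sequences `0 ⟶ Z n ⟶ K n ⟶ Z (n + 1) ⟶ 0` belong to `E`. -/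
def IsAcyclicComplex (E : ObjectProperty (ShortComplex C)) (K : CochainComplex C ℤ) : Prop :=
  ∃ (Z : ℤ → C) (ι : ∀ n, Z n ⟶ K.X n) (π : ∀ n, K.X n ⟶ Z (n + 1)) (w : ∀ n, ι n ≫ π n = 0),
    (∀ n, π n ≫ ι (n + 1) = K.d n (n + 1)) ∧ ∀ n, E (ShortComplex.mk (ι n) (π n) (w n))

lemma IsAcyclicComplex.acyclic_map {B : Type u} [Category.{v} B] [Abelian B]
    {E : ObjectProperty (ShortComplex C)} {K : CochainComplex C ℤ} (hK : IsAcyclicComplex E K)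
    (G : C ⥤ B) [G.Additive] (hG : ∀ S, E S → (S.map G).ShortExact) :
    ((G.mapHomologicalComplex (.up ℤ)).obj K).Acyclic := by
  obtain ⟨Z, ι, π, w, hd, hE⟩ := hK
  intro n
  obtain ⟨m, rfl⟩ : ∃ m, n = m + 1 := ⟨n - 1, by lia⟩
  rw [HomologicalComplex.exactAt_iff' _ m (m + 1) (m + 1 + 1) (by simp) (by simp)]
  have h₀ := hG _ (hE m)
  have h₁ := hG _ (hE (m + 1))
  have h₂ := hG _ (hE (m + 1 + 1))
  let T := (ShortComplex.mk (ι (m + 1)) (π (m + 1)) (w (m + 1))).map G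
  let T' := ((G.mapHomologicalComplex (.up ℤ)).obj K).sc' m (m + 1) (m + 1 + 1)
  let U : ShortComplex B := ShortComplex.mk (G.map (π m) ≫ G.map (ι (m + 1))) (G.map (π (m + 1)))
    (by rw [assoc, ← G.map_comp, w, G.map_zero, comp_zero])
  let a : U ⟶ T :=
    { τ₁ := G.map (π m)
      τ₂ := 𝟙 _
      τ₃ := 𝟙 _
      comm₁₂ := (comp_id _).symm
      comm₂₃ := (id_comp _).trans (comp_id _).symm }
  have e₁ : G.map (K.d m (m + 1)) = G.map (π m) ≫ G.map (ι (m + 1)) := by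
    rw [← G.map_comp, hd]
  have e₂ : G.map (K.d (m + 1) (m + 1 + 1)) = G.map (π (m + 1)) ≫ G.map (ι (m + 1 + 1)) := by
    rw [← G.map_comp, hd]
  let b : U ⟶ T' :=
    { τ₁ := 𝟙 _
      τ₂ := 𝟙 _
      τ₃ := G.map (ι (m + 1 + 1))
      comm₁₂ := (id_comp _).trans (e₁.trans (comp_id _).symm)
      comm₂₃ := (id_comp _).trans e₂ }
  have : Epi a.τ₁ := h₀.epi_g
  have : Mono b.τ₃ := h₂.mono_f
  have : IsIso a.τ₂ := inferInstanceAs (IsIso (𝟙 _))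
  have : Mono a.τ₃ := inferInstanceAs (Mono (𝟙 _))
  have : Epi b.τ₁ := inferInstanceAs (Epi (𝟙 _))
  have : IsIso b.τ₂ := inferInstanceAs (IsIso (𝟙 _))
  exact (ShortComplex.exact_iff_of_epi_of_isIso_of_mono b).1
    ((ShortComplex.exact_iff_of_epi_of_isIso_of_mono a).2 h₁.exact)

end

namespace FilteredObject
variable {B : Type u} [Category.{v} B] [Abelian B]

lemma exactAt_step (K : CochainComplex (FilteredObject B) ℤ) (n i : ℤ)
    (h : (((step B (i - 1)).mapHomologicalComplex (.up ℤ)).obj K).ExactAt n)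
    (h' : (((gr B i).mapHomologicalComplex (.up ℤ)).obj K).ExactAt n) :
    (((step B i).mapHomologicalComplex (.up ℤ)).obj K).ExactAt n := by
  let S : ShortComplex (CochainComplex B ℤ) := ShortComplex.mk
    ((NatTrans.mapHomologicalComplex (stepIncl B i) (.up ℤ)).app K)
    ((NatTrans.mapHomologicalComplex (stepProj B i) (.up ℤ)).app K)
    (by ext j; exact stepIncl_stepProj i (K.X j))
  have hS : S.ShortExact := HomologicalComplex.shortExact_of_degreewise_shortExact S
    (fun j => step_shortExact i (K.X j))
  rw [HomologicalComplex.exactAt_iff_isZero_homology] at h h' ⊢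
  exact (hS.homology_exact₂ n).isZero_of_both_zeros (h.eq_of_src _ _) (h'.eq_of_tgt _ _)

lemma isZero_step {i : ℤ} {X : FilteredObject B} (h : X.W i = ⊥) : IsZero ((step B i).obj X) := by
  have h₀ : (X.W i).arrow = 0 := by
    rw [← Subobject.bot_factors_iff_zero, ← h]
    exact Subobject.factors_self _
  have : (stepArrow B i).app X = 0 := h₀
  rw [IsZero.iff_id_eq_zero, ← cancel_mono ((stepArrow B i).app X), this, comp_zero, comp_zero]

lemma forget_acyclic (K : CochainComplex (FilteredObject B) ℤ)
    (hK : IsAcyclicComplex (exactStructure B) K) :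
    (((forget B).mapHomologicalComplex (.up ℤ)).obj K).Acyclic := by
  intro n
  have hgr (i : ℤ) := hK.acyclic_map (gr B i) (fun S hS => (hS i).some.shortExact) n
  obtain ⟨N₀, h₀⟩ := (K.X (n - 1)).finite
  obtain ⟨N₁, h₁⟩ := (K.X n).finite
  obtain ⟨N₂, h₂⟩ := (K.X (n + 1)).finite
  let N := max (max N₀ N₁) (max N₂ 0)
  have key : ∀ m : ℕ, (((step B (-N + m)).mapHomologicalComplex (.up ℤ)).obj K).ExactAt n := by
    intro m
    induction m with
    | zero =>
      rw [HomologicalComplex.exactAt_iff]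
      apply ShortComplex.exact_of_isZero_X₂
      exact isZero_step (by simpa using (h₁ N (by lia)).2)
    | succ m ih =>
      apply exactAt_step _ _ _ _ (hgr _)
      rwa [show -N + ((m + 1 : ℕ) : ℤ) - 1 = -N + m by push_cast; lia]
  have hN := key (2 * N).toNat
  rw [show -N + ((2 * N).toNat : ℤ) = N by lia] at hN
  have hiso (j : ℤ) (hj : (K.X j).W N = ⊤) : IsIso ((stepArrow B N).app (K.X j)) := by
    change IsIso ((K.X j).W N).arrow
    exact (Subobject.isIso_iff_mk_eq_top _).2 (by rw [Subobject.mk_arrow, hj])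
  rw [HomologicalComplex.exactAt_iff' _ (n - 1) n (n + 1) (by simp) (by simp)] at hN ⊢
  have i₀ := hiso _ (h₀ N (by lia)).1
  have i₁ := hiso _ (h₁ N (by lia)).1
  have i₂ := hiso _ (h₂ N (by lia)).1
  let a := (HomologicalComplex.shortComplexFunctor' B (.up ℤ) (n - 1) n (n + 1)).map
    ((NatTrans.mapHomologicalComplex (stepArrow B N) (.up ℤ)).app K)
  have : Epi a.τ₁ := inferInstanceAs (Epi ((stepArrow B N).app (K.X (n - 1))))
  have : IsIso a.τ₂ := i₁
  have : Mono a.τ₃ := inferInstanceAs (Mono ((stepArrow B N).app (K.X (n + 1))))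
  exact (ShortComplex.exact_iff_of_epi_of_isIso_of_mono a).1 hN

end FilteredObject

section
variable (C : Type u') [Category.{v'} C] [Preadditive C]

/-- The property of being a bounded complex, in the homotopy category of cochain complexes. -/
def boundedHomotopy : ObjectProperty (HomotopyCategory C (.up ℤ)) := fun K =>
  ∃ a b : ℤ, ∀ n : ℤ, n < a ∨ b < n → IsZero (K.as.X n)

instance [HasZeroObject C] : (boundedHomotopy C).ContainsZero where
  exists_zero := ⟨(HomotopyCategory.quotient _ _).obj 0, Functor.map_isZero _ (isZero_zero _),
    0, 0, fun n _ => (HomologicalComplex.eval C _ n).map_isZero (isZero_zero _)⟩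

instance : (boundedHomotopy C).IsStableUnderShift ℤ where
  isStableUnderShiftBy n :=
    { le_shift := by
        intro K hK
        obtain ⟨K, rfl⟩ := HomotopyCategory.quotient_obj_surjective K
        obtain ⟨a, b, h⟩ := hK
        rw [ObjectProperty.prop_shift_iff, HomotopyCategory.shift_quotient_obj]
        exact ⟨a - n, b - n, fun m hm => h (m + n) (by lia)⟩ }

variable [HasZeroObject C] [HasBinaryBiproducts C]

instance : (boundedHomotopy C).IsTriangulatedClosed₃ where
  ext₃' T hT h₁ h₂ := by
    obtain ⟨a₁, b₁, h₁⟩ := h₁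
    obtain ⟨a₂, b₂, h₂⟩ := h₂
    obtain ⟨f : T.obj₁.as ⟶ T.obj₂.as, hf⟩ :=
      (HomotopyCategory.quotient _ _).map_surjective T.mor₁
    refine ⟨(HomotopyCategory.quotient _ _).obj (CochainComplex.mappingCone f), ?_,
      ⟨Triangle.π₃.mapIso (isoTriangleOfIso₁₂ T _ hT
        (HomotopyCategory.mappingCone_triangleh_distinguished f)
        (Iso.refl _) (Iso.refl _) ((comp_id _).trans (hf.symm.trans (id_comp _).symm)))⟩⟩
    refine ⟨min (a₁ - 1) a₂, max b₁ b₂, fun n hn => ?_⟩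
    exact (CochainComplex.mappingCone.isZero_X_iff f n).2 ⟨h₁ _ (by lia), h₂ _ (by lia)⟩

instance : (boundedHomotopy C).IsTriangulated where
  toIsTriangulatedClosed₂ := .of_isTriangulatedClosed₃

/-- The bounded homotopy category of an additive category. -/
abbrev BoundedHomotopyCategory := (boundedHomotopy C).FullSubcategory

variable {C}

/-- The bounded complexes that are acyclic with respect to `E`. -/
def acyclicBounded (E : ObjectProperty (ShortComplex C)) :
    ObjectProperty (BoundedHomotopyCategory C) :=
  fun K => IsAcyclicComplex E K.obj.as

/-- The bounded derived category of `C` with respect to a class `E` of short exact sequences: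
the Verdier quotient of the bounded homotopy category by the thick subcategory generated by
the acyclic complexes (passing to the thick subcategory does not change the quotient). -/
abbrev BoundedDerivedCategory (E : ObjectProperty (ShortComplex C)) :=
  (acyclicBounded E).triangEnvelope.trW.Localization

variable (C) in
/-- The functor from `C` to the bounded homotopy category: complexes concentrated in degree `0`. -/
noncomputable def boundedHomotopySingle : C ⥤ BoundedHomotopyCategory C :=
  (boundedHomotopy C).lift (HomotopyCategory.singleFunctor C 0) (fun X =>
    ⟨0, 0, fun n hn => HomologicalComplex.isZero_single_obj_X (.up ℤ) 0 X n (by lia)⟩)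

namespace BoundedDerivedCategory

variable (E : ObjectProperty (ShortComplex C))

/-- The quotient functor from the bounded homotopy category. -/
abbrev Qh : BoundedHomotopyCategory C ⥤ BoundedDerivedCategory E :=
  (acyclicBounded E).triangEnvelope.trW.Q

/-- The functor from `C` to its bounded derived category: complexes concentrated in degree `0`. -/
noncomputable def single : C ⥤ BoundedDerivedCategory E :=
  boundedHomotopySingle C ⋙ Qh E

end BoundedDerivedCategory

end

namespace FilteredObject

variable (B : Type u) [Category.{v} B] [Abelian B]

instance : (acyclicBounded (exactStructure B)).Nonempty where
  exists_prop := by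
    refine ⟨⟨(HomotopyCategory.quotient _ _).obj 0, 0, 0, fun n _ =>
      (HomologicalComplex.eval _ _ n).map_isZero (isZero_zero _)⟩, fun _ => 0, fun _ => 0,
      fun _ => 0, fun _ => zero_comp, fun _ => ?_, fun _ i => ?_⟩
    · exact (IsZero.eq_of_src ((HomologicalComplex.eval _ _ _).map_isZero (isZero_zero _)) _ _)
    · have h : IsZero ((gr B i).obj (0 : FilteredObject B)) := (gr B i).map_isZero (isZero_zero _)
      have h' (n : ℤ) : IsZero ((gr B i).obj (HomologicalComplex.X
        (0 : CochainComplex (FilteredObject B) ℤ) n)) :=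
          (gr B i).map_isZero ((HomologicalComplex.eval _ _ n).map_isZero (isZero_zero _))
      exact ⟨{ r := 0, s := 0, f_r := h.eq_of_src _ _, s_g := h.eq_of_src _ _,
               id := (h' _).eq_of_src _ _ }⟩

/-- The bounded derived category `D^b(FB)` of the exact category of filtered objects. -/
abbrev DerivedBounded := BoundedDerivedCategory (exactStructure B)

/-- The functor `K^b(FB) ⥤ K(B)` that forgets the filtrations. -/
noncomputable abbrev forgetHomotopy : BoundedHomotopyCategory (FilteredObject B) ⥤
    HomotopyCategory B (.up ℤ) :=
  (boundedHomotopy (FilteredObject B)).ι ⋙ (forget B).mapHomotopyCategory (.up ℤ)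

instance : ((HomotopyCategory.subcategoryAcyclic B).inverseImage
    (forgetHomotopy B)).IsStableUnderRetracts where
  of_retract {X Y} r h := by
    have h' := (HomotopyCategory.mem_subcategoryAcyclic_iff _).1 h
    refine (HomotopyCategory.mem_subcategoryAcyclic_iff _).2 (fun n => ?_)
    let r' := r.map (forgetHomotopy B ⋙ HomotopyCategory.homologyFunctor B (.up ℤ) n)
    exact IsZero.of_mono r'.i (h' n)

lemma acyclic_le : (acyclicBounded (exactStructure B)).triangEnvelope ≤
    (HomotopyCategory.subcategoryAcyclic B).inverseImage (forgetHomotopy B) := by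
  rw [ObjectProperty.triangEnvelope_le_iff]
  intro K hK
  exact (HomotopyCategory.quotient_obj_mem_subcategoryAcyclic_iff_acyclic _).2
    (forget_acyclic _ hK)

variable {B} in
/-- The object `V{i}` of `D^b(FB)`, placed in degree `0`. -/
noncomputable def DerivedBounded.of (i : ℤ) (V : B) : DerivedBounded B :=
  (BoundedDerivedCategory.single (exactStructure B)).obj (FilteredObject.single i V)

variable [HasDerivedCategory.{w} B]

/-- The bounded derived category `D^b(B)` of an abelian category, as the full subcategory of
its derived category that consists of the cohomologically bounded complexes. -/
abbrev _root_.AbelianDerivedBounded :=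
  (DerivedCategory.TStructure.t (C := B)).bounded.FullSubcategory

/-- The functor `B ⥤ D^b(B)`: complexes concentrated in degree `0`. -/
noncomputable def _root_.AbelianDerivedBounded.single : B ⥤ AbelianDerivedBounded B :=
  (DerivedCategory.TStructure.t (C := B)).bounded.lift (DerivedCategory.singleFunctor B 0)
    (fun _ => ⟨⟨0, inferInstance⟩, ⟨0, inferInstance⟩⟩)

/-- The functor `K^b(FB) ⥤ D^b(B)` that forgets the filtrations. -/
noncomputable def forgetDerivedAux :
    BoundedHomotopyCategory (FilteredObject B) ⥤ AbelianDerivedBounded B :=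
  (DerivedCategory.TStructure.t (C := B)).bounded.lift (forgetHomotopy B ⋙ DerivedCategory.Qh) (by
    rintro ⟨K, hK⟩
    obtain ⟨K, rfl⟩ := HomotopyCategory.quotient_obj_surjective K
    obtain ⟨a, b, h⟩ := hK
    let L : CochainComplex B ℤ := ((forget B).mapHomologicalComplex (.up ℤ)).obj K
    have hL (n : ℤ) (hn : n < a ∨ b < n) : IsZero (L.X n) := (forget B).map_isZero (h n hn)
    have : L.IsStrictlyGE a := (CochainComplex.isStrictlyGE_iff L a).2 (fun n hn => hL n (by lia))
    have : L.IsStrictlyLE b := (CochainComplex.isStrictlyLE_iff L b).2 (fun n hn => hL n (by lia))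
    let e : DerivedCategory.Q.obj L ≅ (forgetHomotopy B ⋙ DerivedCategory.Qh).obj
      ⟨(HomotopyCategory.quotient _ _).obj K, a, b, h⟩ :=
        (DerivedCategory.quotientCompQhIso B).symm.app L
    exact (DerivedCategory.TStructure.t (C := B)).bounded.prop_of_iso e
      ⟨⟨a, (DerivedCategory.isGE_Q_obj_iff L a).2 inferInstance⟩,
        ⟨b, (DerivedCategory.isLE_Q_obj_iff L b).2 inferInstance⟩⟩)

lemma forgetDerivedAux_inverts :
    (acyclicBounded (exactStructure B)).triangEnvelope.trW.IsInvertedBy (forgetDerivedAux B) := by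
  intro K L f hf
  rw [← isIso_iff_of_reflects_iso _ (DerivedCategory.TStructure.t (C := B)).bounded.ι]
  refine ObjectProperty.inverseImage_trW_isInverted (F := forgetHomotopy B)
    (P := HomotopyCategory.subcategoryAcyclic B) DerivedCategory.Qh f ?_
  exact ObjectProperty.trW_monotone (acyclic_le B) _ hf

noncomputable instance : (forgetDerivedAux B).CommShift ℤ := by
  dsimp only [forgetDerivedAux]
  infer_instance

/-- The functor `Φ : D^b(FB) ⥤ D^b(B)` induced by forgetting the filtrations. -/
noncomputable def forgetDerived : DerivedBounded B ⥤ AbelianDerivedBounded B :=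
  Localization.lift (forgetDerivedAux B) (forgetDerivedAux_inverts B)
    (BoundedDerivedCategory.Qh (exactStructure B))

/-- `Φ` is induced by the functor `K^b(FB) ⥤ D^b(B)`. -/
noncomputable def forgetDerivedFactors :
    BoundedDerivedCategory.Qh (exactStructure B) ⋙ forgetDerived B ≅ forgetDerivedAux B :=
  Localization.fac _ _ _

noncomputable instance : Localization.Lifting (BoundedDerivedCategory.Qh (exactStructure B))
    (acyclicBounded (exactStructure B)).triangEnvelope.trW (forgetDerivedAux B)
    (forgetDerived B) :=
  ⟨forgetDerivedFactors B⟩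

/-- `Φ` commutes with the shifts. -/
noncomputable instance : (forgetDerived B).CommShift ℤ :=
  Functor.commShiftOfLocalization (BoundedDerivedCategory.Qh (exactStructure B))
    (acyclicBounded (exactStructure B)).triangEnvelope.trW ℤ (forgetDerivedAux B) _

/-- The canonical isomorphism between `Φ` of a filtered object placed in degree `0`, and
its underlying object placed in degree `0`. -/
noncomputable def forgetDerivedSingleIso (X : FilteredObject B) :
    (forgetDerived B).obj ((BoundedDerivedCategory.single (exactStructure B)).obj X) ≅
      (AbelianDerivedBounded.single B).obj X.obj :=
  (forgetDerivedFactors B).app _ ≪≫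
    (DerivedCategory.TStructure.t (C := B)).bounded.fullyFaithfulι.preimageIso
      (DerivedCategory.Qh.mapIso ((HomotopyCategory.quotient B (.up ℤ)).mapIso
        ((HomologicalComplex.singleMapHomologicalComplex (forget B) (.up ℤ) 0).app X)))

end FilteredObject

/-! The filtered object `V{i}` sits in the single weight `-i`. Both assertions are proved by
dimension shifting, which lowers `n` by one and raises `i` by one.

Let `p : E ⟶ V` be an epimorphism of `B`. Give `E` the filtration with `ker p` in weight `-i - 1`
and `E` in weight `-i`. Then `0 ⟶ (ker p){i + 1} ⟶ E ⟶ V{i} ⟶ 0` belongs to the exact structure,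
since in each weight one of the outer graded pieces vanishes (`extension_exact`). It yields a
distinguished triangle with connecting map `δ : V{i} ⟶ (ker p){i + 1}[1]` (`exists_distinguished`).

For `n > 0`, every morphism `V ⟶ V'[n]` of `D^b(B)` is killed by some epimorphism `p`. Every
morphism `V{i} ⟶ Y[n]` of `D^b(FB)` is killed by the projection of such a filtered `E`. The filtered
statement uses left fractions by complexes in degrees `≤ 0`, together with a pullback that cuts `E`
out of an arbitrary admissible epimorphism (`exists_extension_comp_eq`). So morphisms of degree `n +
1` out of `V{i}` factor as `δ` followed by a morphism of degree `n` out of `(ker p){i + 1}`, and `n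
- (j - i)` becomes `n - (j - (i + 1))` in degree `n`: the position relative to the bound is
preserved.

This gives the vanishing, and the surjectivity of `Φ`. For injectivity, the filtered object `E` is
replaced by `E{i + 1}`: the identity of `E` is a filtered morphism between them which `Φ` inverts,
so the induction hypothesis applies to `E{i + 1}` as well as to `(ker p){i + 1}`.

The induction starts at `n = 0`, where `FB ⥤ D^b(FB)` is fully faithful and Homs between objects of
one weight are explicit. For `n < 0` all groups vanish. The tool for computing in `D^b(FB)` is
`trW_iff_grHom`: the functors `Hom(U, Gr^k -)` detect which morphisms become invertible. -/

namespace FilteredObject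

/-! ### Linearity and exactness of `Φ`; reduction to bijectivity -/

section

variable (B : Type u) [Category.{v} B] [Abelian B] [HasDerivedCategory.{w} B]

instance : (forgetDerivedAux B).IsTriangulated := by
  dsimp only [forgetDerivedAux]
  infer_instance

noncomputable instance : NatTrans.CommShift (forgetDerivedFactors B).hom ℤ :=
  inferInstanceAs (NatTrans.CommShift (Localization.Lifting.iso
    (BoundedDerivedCategory.Qh (exactStructure B))
    (acyclicBounded (exactStructure B)).triangEnvelope.trW (forgetDerivedAux B)
    (forgetDerived B)).hom ℤ)

instance : (BoundedDerivedCategory.Qh (exactStructure B)).mapArrow.EssSurj :=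
  Localization.essSurj_mapArrow _ (acyclicBounded (exactStructure B)).triangEnvelope.trW

instance : (forgetDerived B).IsTriangulated :=
  Functor.isTriangulated_of_precomp_iso (forgetDerivedFactors B)

variable {B} {A : Type t} [CommRing A] [Linear A B]

instance : (forgetDerivedAux B).Linear A where
  map_smul f r := by
    dsimp only [forgetDerivedAux]
    have : (forgetHomotopy B ⋙ DerivedCategory.Qh).Linear A := inferInstance
    ext
    exact (forgetHomotopy B ⋙ DerivedCategory.Qh).map_smul r f

instance : (forgetDerived B).Linear A :=
  (Localization.functor_linear_iff (BoundedDerivedCategory.Qh (exactStructure B))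
    (acyclicBounded (exactStructure B)).triangEnvelope.trW A (forgetDerivedAux B)
    (forgetDerived B)).1 inferInstance

end

/-- `Φ` is already `A`-linear and the canonical identifications of its values are isomorphisms, so
only bijectivity on Hom sets remains to be shown. -/
lemma exists_linearEquiv_of_bijective {A : Type t} [CommRing A] {B : Type u} [Category.{v} B]
    [Abelian B] [Linear A B] [HasDerivedCategory.{w} B] (V V' : B) (i j n : ℤ)
    (h : Function.Bijective
      ((forgetDerived B).map : (DerivedBounded.of i V ⟶ (DerivedBounded.of j V')⟦n⟧) → _)) :
    ∃ e : (DerivedBounded.of i V ⟶ (DerivedBounded.of j V')⟦n⟧) ≃ₗ[A]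
        ((AbelianDerivedBounded.single B).obj V ⟶ ((AbelianDerivedBounded.single B).obj V')⟦n⟧),
      ∀ f, e f = (forgetDerivedSingleIso B (single i V)).inv ≫ (forgetDerived B).map f ≫
        ((forgetDerived B).commShiftIso n).hom.app _ ≫
          (forgetDerivedSingleIso B (single j V')).hom⟦n⟧' := by
  let e₁ : (DerivedBounded.of i V ⟶ (DerivedBounded.of j V')⟦n⟧) ≃ₗ[A]
      ((forgetDerived B).obj (DerivedBounded.of i V) ⟶
        (forgetDerived B).obj ((DerivedBounded.of j V')⟦n⟧)) :=
    LinearEquiv.ofBijective ((forgetDerived B).mapLinearMap A) h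
  exact ⟨e₁.trans (Linear.homCongr A (forgetDerivedSingleIso B (single i V))
    (((forgetDerived B).commShiftIso n).app _ ≪≫
      (shiftFunctor _ n).mapIso (forgetDerivedSingleIso B (single j V')))),
    fun f => by simp [e₁, Linear.homCongr]; rfl⟩

end FilteredObject

/-! ### The filtered extension attached to a morphism `E ⟶ V` -/

namespace FilteredObject

variable {B : Type u} [Category.{v} B] [Abelian B]

lemma factors_arrow_comp_of_eq_bot {X Y : B} {P : Subobject X} (h : P = ⊥) (Q : Subobject Y)
    (f : X ⟶ Y) : Q.Factors (P.arrow ≫ f) := by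
  subst h
  rw [Subobject.bot_arrow, zero_comp]
  exact Subobject.factors_zero

lemma factors_arrow_comp_of_eq_kernelSubobject {X Y Z : B} {P : Subobject X} {p : X ⟶ Z}
    (h : P = kernelSubobject p) {Q : Subobject Y} {f : X ⟶ Y} (hf : Q.Factors (kernel.ι p ≫ f)) :
    Q.Factors (P.arrow ≫ f) := by
  subst h
  rw [← kernelSubobject_arrow p, assoc]
  exact Subobject.factors_of_factors_right _ hf

lemma single_W_of_le {i k : ℤ} (V : B) (h : -i ≤ k) : (single i V).W k = ⊤ := if_pos h

lemma single_W_of_lt {i k : ℤ} (V : B) (h : k < -i) : (single i V).W k = ⊥ := if_neg (by lia)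

/-- A morphism out of a filtered object concentrated in a single weight. -/
def homOfSingle {i : ℤ} {V : B} {X : FilteredObject B} (f : V ⟶ X.obj)
    (hf : (X.W (-i)).Factors f) : single i V ⟶ X where
  f := f
  factors k := by
    obtain h | h := le_or_gt (-i) k
    · exact Subobject.factors_of_factors_right _
        (Subobject.factors_of_le f (X.monotone h) hf)
    · exact factors_arrow_comp_of_eq_bot (single_W_of_lt V h) _ _

lemma factors_of_W_eq_top {X : FilteredObject B} {k : ℤ} (h : X.W k = ⊤) {T : B}
    (f : T ⟶ X.obj) : (X.W k).Factors f := by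
  rw [h]; exact Subobject.top_factors f

/-- For `p : E ⟶ V`, the filtration on `E` whose graded pieces are the image of `p` in weight `-i`
and the kernel of `p` in weight `-i - 1`. -/
noncomputable def extension (i : ℤ) {E V : B} (p : E ⟶ V) : FilteredObject B where
  obj := E
  W k := if -i ≤ k then ⊤ else if -i - 1 ≤ k then kernelSubobject p else ⊥
  monotone k l h := by
    dsimp only
    split_ifs <;> first | exact le_top | exact bot_le | exact le_rfl | lia
  finite := ⟨|i| + 2, fun k hk => ⟨if_pos (by grind), by
    rw [if_neg (by grind), if_neg (by grind)]⟩⟩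

section

variable (i : ℤ) {E V : B} (p : E ⟶ V)

lemma extension_W_of_le {k : ℤ} (h : -i ≤ k) : (extension i p).W k = ⊤ := if_pos h

lemma extension_W_eq : (extension i p).W (-i - 1) = kernelSubobject p := by
  change (if -i ≤ -i - 1 then ⊤ else if -i - 1 ≤ -i - 1 then kernelSubobject p else ⊥) = _
  rw [if_neg (by lia), if_pos le_rfl]

lemma extension_W_of_lt {k : ℤ} (h : k < -i - 1) : (extension i p).W k = ⊥ := by
  change (if -i ≤ k then ⊤ else if -i - 1 ≤ k then kernelSubobject p else ⊥) = _
  rw [if_neg (by lia), if_neg (by lia)]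
  rfl

/-- The filtration can jump only in weights `-i - 1` and `-i`, so compatibility in these two weights
implies it in all. -/
lemma extension_factors {X : FilteredObject B} (f : E ⟶ X.obj) (h : (X.W (-i)).Factors f)
    (h' : (X.W (-i - 1)).Factors (kernel.ι p ≫ f)) (k : ℤ) :
    (X.W k).Factors (((extension i p).W k).arrow ≫ f) := by
  obtain hk | hk := le_or_gt (-i) k
  · exact Subobject.factors_of_factors_right _
      (Subobject.factors_of_le f (X.monotone hk) h)
  obtain hk | rfl := (show k ≤ -i - 1 by lia).lt_or_eq
  · exact factors_arrow_comp_of_eq_bot (extension_W_of_lt i p hk) _ _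
  · exact factors_arrow_comp_of_eq_kernelSubobject (extension_W_eq i p) h'

/-- A morphism out of `extension i p`. -/
noncomputable def homOfExtension {X : FilteredObject B} (f : E ⟶ X.obj) (h : (X.W (-i)).Factors f)
    (h' : (X.W (-i - 1)).Factors (kernel.ι p ≫ f)) : extension i p ⟶ X :=
  ⟨f, extension_factors i p f h h'⟩

/-- The projection of `extension i p`. -/
noncomputable def extensionProj : extension i p ⟶ single i V :=
  homOfExtension i p p (factors_of_W_eq_top (single_W_of_le _ le_rfl) _)
    ((congr_arg _ (kernel.condition p)).mpr Subobject.factors_zero)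

/-- The inclusion of the kernel in `extension i p`. -/
noncomputable def extensionIncl : single (i + 1) (kernel p) ⟶ extension i p :=
  homOfSingle (kernel.ι p) (by
    rw [show -(i + 1) = -i - 1 by lia, extension_W_eq]
    exact (kernelSubobject_factors_iff p _).2 (kernel.condition p))

/-- The identity morphism, from `extension i p` to an object of weight `-(i + 1)`. -/
noncomputable def extensionToSingle : extension i p ⟶ single (i + 1) E :=
  homOfExtension i p (𝟙 E) (factors_of_W_eq_top (single_W_of_le _ (by lia)) _)
    (factors_of_W_eq_top (single_W_of_le _ (by lia)) _)

/-- The sequence `0 ⟶ (kernel p){i + 1} ⟶ E ⟶ V{i} ⟶ 0`. -/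
noncomputable def extensionShortComplex : ShortComplex (FilteredObject B) :=
  ShortComplex.mk (extensionIncl i p) (extensionProj i p)
    (hom_ext (kernel.condition p))

end

end FilteredObject

/-! ### Effacing positive degree morphisms of `D^b(B)` by epimorphisms -/

namespace AbelianDerivedBounded

variable {B : Type u} [Category.{v} B] [Abelian B] [HasDerivedCategory.{w} B]

/-- Write `f` as a fraction `g ∘ s⁻¹` with roof a complex `X` in degrees `≤ 0`. Then `X⁰` in degree
`0` maps to `X`. Its composite with `s` is an epimorphism `p`, and its composite with `g` vanishes
because `V'` lies in degree `m ≠ 0`. -/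
lemma _root_.DerivedCategory.exists_epi_comp_eq_zero {V V' : B} {m : ℤ} (hm : m ≠ 0)
    (f : (DerivedCategory.singleFunctor B 0).obj V ⟶ (DerivedCategory.singleFunctor B m).obj V') :
    ∃ (E : B) (p : E ⟶ V) (_ : Epi p), (DerivedCategory.singleFunctor B 0).map p ≫ f = 0 := by
  let S (n : ℤ) (V : B) := (CochainComplex.singleFunctor B n).obj V
  change DerivedCategory.Q.obj (S 0 V) ⟶ DerivedCategory.Q.obj (S m V') at f
  obtain ⟨X, _, s, _, g, rfl⟩ := DerivedCategory.right_fac_of_isStrictlyLE f 0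
  let φ : S 0 (X.X 0) ⟶ X := HomologicalComplex.mkHomFromSingle (𝟙 _) (fun i hi => by
    obtain rfl : i = 1 := by simpa using hi.symm
    exact (X.isZero_of_isStrictlyLE 0 1 (by lia)).eq_of_tgt _ _)
  obtain ⟨p, hp⟩ := (CochainComplex.singleFunctor B 0).map_surjective (φ ≫ s)
  have hφ : φ.f 0 = (HomologicalComplex.singleObjXSelf (.up ℤ) 0 (X.X 0)).hom := by
    exact (HomologicalComplex.mkHomFromSingle_f _ _).trans (comp_id _)
  have hg : φ ≫ g = 0 := by
    apply HomologicalComplex.from_single_hom_ext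
    exact (HomologicalComplex.isZero_single_obj_X (.up ℤ) m V' 0 hm.symm).eq_of_tgt _ _
  refine ⟨X.X 0, p, ⟨fun {W} u v huv => ?_⟩, ?_⟩
  -- `p` is epi: if `u` and `v` agree after `p`, they agree after `s` in degree `0`, hence after
  -- `s`, which is invertible in the derived category.
  · apply (DerivedCategory.singleFunctor B 0).map_injective
    change DerivedCategory.Q.map ((CochainComplex.singleFunctor B 0).map u) =
      DerivedCategory.Q.map ((CochainComplex.singleFunctor B 0).map v)
    rw [← cancel_epi (DerivedCategory.Q.map s), ← Functor.map_comp, ← Functor.map_comp]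
    congr 1
    apply HomologicalComplex.to_single_hom_ext
    have : Epi (φ.f 0) := by
      rw [hφ]
      exact inferInstanceAs (Epi (HomologicalComplex.singleObjXSelf (.up ℤ) 0 (X.X 0)).hom)
    have h : φ ≫ s ≫ (CochainComplex.singleFunctor B 0).map u =
        φ ≫ s ≫ (CochainComplex.singleFunctor B 0).map v := by
      rw [← assoc, ← assoc, ← hp, ← Functor.map_comp, ← Functor.map_comp, huv]
    exact (cancel_epi (φ.f 0)).1 (congr_arg (HomologicalComplex.Hom.f · 0) h)
  · change DerivedCategory.Q.map ((CochainComplex.singleFunctor B 0).map p) ≫ _ = 0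
    have h : DerivedCategory.Q.map (φ ≫ s) ≫ inv (DerivedCategory.Q.map s) ≫
        DerivedCategory.Q.map g = 0 := by
      rw [Functor.map_comp, assoc, IsIso.hom_inv_id_assoc, ← Functor.map_comp, hg,
        Functor.map_zero]
    rw [hp]
    exact h

/-- The object `V[n]` of the derived category is `V` placed in degree `-n`. -/
noncomputable def shiftSingleIso (V : B) (n : ℤ) :
    (((single B).obj V)⟦n⟧).obj ≅ (DerivedCategory.singleFunctor B (-n)).obj V :=
  ((DerivedCategory.TStructure.t (C := B)).bounded.ι.commShiftIso n).app _ ≪≫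
    ((DerivedCategory.singleFunctors B).shiftIso n (-n) 0 (by simp)).app V

lemma exists_epi_comp_eq_zero {V V' : B} {n : ℤ} (hn : 0 < n)
    (f : (single B).obj V ⟶ ((single B).obj V')⟦n⟧) :
    ∃ (E : B) (p : E ⟶ V) (_ : Epi p), (single B).map p ≫ f = 0 := by
  obtain ⟨E, p, hp, h⟩ := DerivedCategory.exists_epi_comp_eq_zero (by lia)
    (f.hom ≫ (shiftSingleIso V' n).hom)
  refine ⟨E, p, hp, ?_⟩
  ext
  rw [← cancel_mono (shiftSingleIso V' n).hom]
  exact (assoc _ _ _).trans (h.trans zero_comp.symm)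

lemma hom_shift_eq_zero {V V' : B} {n : ℤ} (hn : n < 0)
    (f : (single B).obj V ⟶ ((single B).obj V')⟦n⟧) : f = 0 := by
  ext
  rw [← cancel_mono (shiftSingleIso V' n).hom]
  exact (DerivedCategory.subsingleton_hom_of_isStrictlyLE_of_isStrictlyGE
    ((CochainComplex.singleFunctor B 0).obj V) ((CochainComplex.singleFunctor B (-n)).obj V') 0 (-n)
    (by lia)).elim _ _

end AbelianDerivedBounded

/-! ### Exactness of graded pieces from exactness of filtration steps -/

namespace FilteredObject

variable {B : Type u} [Category.{v} B] [Abelian B]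

lemma isZero_gr {k : ℤ} {X : FilteredObject B} (h : X.W (k - 1) = X.W k) :
    IsZero ((gr B k).obj X) := by
  have : (stepProj B k).app X = 0 := by
    have : IsIso ((stepIncl B k).app X) := by
      have h' : (stepIncl B k).app X ≫ Subobject.ofLE _ _ h.ge = 𝟙 _ :=
        (Subobject.ofLE_comp_ofLE _ _ _ _ _).trans (Subobject.ofLE_refl _)
      have h'' : Subobject.ofLE _ _ h.ge ≫ (stepIncl B k).app X = 𝟙 _ :=
        (Subobject.ofLE_comp_ofLE _ _ _ _ _).trans (Subobject.ofLE_refl _)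
      exact ⟨_, h', h''⟩
    rw [← cancel_epi ((stepIncl B k).app X), stepIncl_stepProj, comp_zero]
  rw [IsZero.iff_id_eq_zero, ← cancel_epi ((stepProj B k).app X), this, zero_comp, zero_comp]

lemma isZero_gr_single {i k : ℤ} (h : k ≠ -i) (V : B) : IsZero ((gr B k).obj (single i V)) := by
  apply isZero_gr
  obtain h | h := h.lt_or_gt
  · rw [single_W_of_lt V h, single_W_of_lt V (by lia)]
  · rw [single_W_of_le V h.le, single_W_of_le V (by lia)]

section

variable {Z X Y Y' : FilteredObject B} {f : Z ⟶ X} {g : X ⟶ Y} (w : f ≫ g = 0) (k : ℤ)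

lemma exists_refinement_of_exact_map {G : FilteredObject B ⥤ B} [G.Additive]
    (h : ((ShortComplex.mk f g w).map G).Exact) {A : B} (x : A ⟶ G.obj X) (hx : x ≫ G.map g = 0) :
    ∃ (A' : B) (π : A' ⟶ A) (_ : Epi π) (z : A' ⟶ G.obj Z), π ≫ x = z ≫ G.map f :=
  h.exact_up_to_refinements x hx

lemma exact_map_of_refinements {G : FilteredObject B ⥤ B} [G.Additive]
    (h : ∀ {A : B} (x : A ⟶ G.obj X), x ≫ G.map g = 0 →
      ∃ (A' : B) (π : A' ⟶ A) (_ : Epi π) (z : A' ⟶ G.obj Z), π ≫ x = z ≫ G.map f) :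
    ((ShortComplex.mk f g w).map G).Exact :=
  (ShortComplex.exact_iff_exact_up_to_refinements _).2 fun _ x hx => h x hx

lemma exists_step_lift {A : B} (y : A ⟶ (step B k).obj X)
    (hy : y ≫ (stepProj B k).app X = 0) : ∃ x, y = x ≫ (stepIncl B k).app X :=
  ⟨(step_shortExact k X).exact.lift y hy, ((step_shortExact k X).exact.lift_f y hy).symm⟩

/-- An element of `W k Z` with image in `W (k - 1) X` has the same image as an element of `W (k - 1)
Z`, by exactness in step `k - 1`; by injectivity in step `k` the two coincide. -/
lemma mono_gr_map [Mono ((step B k).map f)]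
    (h : ((ShortComplex.mk f g w).map (step B (k - 1))).Exact) [Mono ((step B (k - 1)).map f)] :
    Mono ((gr B k).map f) := by
  rw [Preadditive.mono_iff_cancel_zero]
  intro A z hz
  obtain ⟨A₁, π₁, _, z₁, hz₁⟩ := surjective_up_to_refinements_of_epi ((stepProj B k).app Z) z
  obtain ⟨x, hx⟩ := exists_step_lift k (z₁ ≫ (step B k).map f) (by
    rw [assoc, (stepProj B k).naturality, ← reassoc_of% hz₁, hz, comp_zero])
  have hx' : x ≫ (step B (k - 1)).map g = 0 := by
    rw [← cancel_mono ((stepIncl B k).app Y), assoc, (stepIncl B k).naturality, ← reassoc_of% hx,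
      ← Functor.map_comp, w, Functor.map_zero, comp_zero, zero_comp]
  have : Mono ((ShortComplex.mk f g w).map (step B (k - 1))).f :=
    inferInstanceAs (Mono ((step B (k - 1)).map f))
  obtain ⟨z₂, hz₂⟩ : ∃ z₂, z₂ ≫ (step B (k - 1)).map f = x := ⟨h.lift x hx', h.lift_f x hx'⟩
  rw [← cancel_epi π₁, hz₁, comp_zero]
  have : z₁ = z₂ ≫ (stepIncl B k).app Z := by
    rw [← cancel_mono ((step B k).map f), hx, assoc, ← (stepIncl B k).naturality,
      reassoc_of% hz₂]
  rw [this, assoc, stepIncl_stepProj, comp_zero]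

variable {g' : Y ⟶ Y'} (w' : g ≫ g' = 0)

/-- Lift a class killed by `g` to `x₁` in `W k X`. Then `g x₁` lies in `W (k - 1) Y` and is killed
by `g'`, so it equals `g x₂` with `x₂` in `W (k - 1) X`. The difference `x₁ - x₂` represents the
same class and comes from `W k Z`. -/
lemma exact_gr_map (hk : ((ShortComplex.mk f g w).map (step B k)).Exact)
    (hk' : ((ShortComplex.mk g g' w').map (step B (k - 1))).Exact) :
    ((ShortComplex.mk f g w).map (gr B k)).Exact := by
  refine exact_map_of_refinements w fun {A} x hx => ?_
  obtain ⟨A₁, π₁, _, x₁, hx₁⟩ := surjective_up_to_refinements_of_epi ((stepProj B k).app X) x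
  obtain ⟨y, hy⟩ := exists_step_lift k (x₁ ≫ (step B k).map g) (by
    rw [assoc, (stepProj B k).naturality, ← reassoc_of% hx₁, hx, comp_zero])
  obtain ⟨A₂, π₂, _, x₂, hx₂⟩ := exists_refinement_of_exact_map w' hk' y (by
    rw [← cancel_mono ((stepIncl B k).app Y'), assoc, (stepIncl B k).naturality, ← reassoc_of% hy,
      ← Functor.map_comp, w', Functor.map_zero, comp_zero, zero_comp])
  obtain ⟨A₃, π₃, _, z, hz⟩ := exists_refinement_of_exact_map w hk
    (π₂ ≫ x₁ - x₂ ≫ (stepIncl B k).app X) (by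
      rw [Preadditive.sub_comp, assoc, assoc, ← (stepIncl B k).naturality, hy, reassoc_of% hx₂,
        sub_self])
  refine ⟨A₃, π₃ ≫ π₂ ≫ π₁, inferInstance, z ≫ (stepProj B k).app Z, ?_⟩
  rw [assoc z, ← (stepProj B k).naturality, ← reassoc_of% hz, Preadditive.sub_comp]
  simp only [assoc, stepIncl_stepProj, comp_zero, sub_zero, hx₁]

end

instance (k : ℤ) {X Y : FilteredObject B} (f : X ⟶ Y) [Mono f.f] : Mono ((step B k).map f) := by
  have : Mono ((step B k).map f ≫ (stepArrow B k).app Y) := by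
    rw [(stepArrow B k).naturality]
    have : Mono ((forget B).map f) := inferInstanceAs (Mono f.f)
    infer_instance
  exact mono_of_mono _ ((stepArrow B k).app Y)

lemma epi_gr_map (k : ℤ) {X Y : FilteredObject B} (f : X ⟶ Y) [Epi ((step B k).map f)] :
    Epi ((gr B k).map f) := by
  have : Epi ((stepProj B k).app X ≫ (gr B k).map f) := by
    rw [← (stepProj B k).naturality]
    infer_instance
  exact epi_of_epi ((stepProj B k).app X) _

lemma exists_step_fac {k : ℤ} {X : FilteredObject B} {T : B} {x : T ⟶ (forget B).obj X}
    (h : (X.W k).Factors x) : ∃ y : T ⟶ (step B k).obj X, y ≫ (stepArrow B k).app X = x :=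
  ⟨(X.W k).factorThru x h, Subobject.factorThru_arrow _ _ h⟩

lemma isIso_stepArrow {k : ℤ} {X : FilteredObject B} (h : X.W k = ⊤) :
    IsIso ((stepArrow B k).app X) := by
  change IsIso (X.W k).arrow
  exact (Subobject.isIso_iff_mk_eq_top _).2 (by rw [Subobject.mk_arrow, h])

lemma epi_step_map {k : ℤ} {X Y : FilteredObject B} (f : X ⟶ Y) [Epi f.f] (h : X.W k = ⊤) :
    Epi ((step B k).map f) := by
  have := isIso_stepArrow h
  have : Epi ((forget B).map f) := inferInstanceAs (Epi f.f)
  have : Epi ((step B k).map f ≫ (stepArrow B k).app Y) := by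
    rw [(stepArrow B k).naturality]
    infer_instance
  have : Epi ((stepArrow B k).app Y) := epi_of_epi ((step B k).map f) _
  have : IsIso ((stepArrow B k).app Y) := isIso_of_mono_of_epi _
  rw [show (step B k).map f = (stepArrow B k).app X ≫ (forget B).map f ≫
    inv ((stepArrow B k).app Y) by
      rw [← (stepArrow B k).naturality_assoc, IsIso.hom_inv_id, comp_id]]
  infer_instance

section

variable {Z X Y Y' : FilteredObject B} {f : Z ⟶ X} {g : X ⟶ Y} (w : f ≫ g = 0) (k : ℤ)

/-- The hypothesis `hW` expresses that `f` is strict, that is, that `Z` carries the filtration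
induced from `X`. -/
lemma step_map_exact (h : ((ShortComplex.mk f g w).map (forget B)).Exact) [Mono f.f]
    (hW : ∀ {T : B} (z : T ⟶ Z.obj), (X.W k).Factors (z ≫ f.f) → (Z.W k).Factors z) :
    ((ShortComplex.mk f g w).map (step B k)).Exact := by
  refine exact_map_of_refinements w fun {A} x hx => ?_
  have : Mono ((ShortComplex.mk f g w).map (forget B)).f := inferInstanceAs (Mono f.f)
  have h₀ : (x ≫ (stepArrow B k).app X) ≫ (forget B).map g = 0 := by
    rw [assoc, ← (stepArrow B k).naturality, reassoc_of% hx, zero_comp]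
  obtain ⟨z, hz⟩ : ∃ z : A ⟶ Z.obj, z ≫ f.f = x ≫ (X.W k).arrow := ⟨h.lift _ h₀, h.lift_f _ h₀⟩
  have hz' : (Z.W k).Factors z := hW z (by rw [hz]; exact Subobject.factors_comp_arrow _)
  obtain ⟨y, hy⟩ := exists_step_fac hz'
  refine ⟨A, 𝟙 A, inferInstance, y, ?_⟩
  rw [← cancel_mono ((stepArrow B k).app X), id_comp, assoc, (stepArrow B k).naturality,
    reassoc_of% hy]
  exact hz.symm

/-- Supplies the second exactness hypothesis of `exact_gr_map` at the right end of a short exact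
sequence, with `g' = 0`. -/
lemma exact_map_of_epi {G : FilteredObject B ⥤ B} [G.Additive] [Epi (G.map g)] :
    ((ShortComplex.mk g (0 : Y ⟶ 0) comp_zero).map G).Exact := by
  rw [ShortComplex.exact_iff_epi]
  · assumption
  · exact G.map_zero _ _

end

lemma extension_exact (i : ℤ) {E V : B} (p : E ⟶ V) [Epi p] :
    exactStructure B (extensionShortComplex i p) := by
  intro k
  have hmono : Mono (extensionIncl i p).f := inferInstanceAs (Mono (kernel.ι p))
  have hepi : Epi (extensionProj i p).f := inferInstanceAs (Epi p)
  have hf : ((extensionShortComplex i p).map (forget B)).Exact :=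
    ShortComplex.exact_kernel p
  have hstep (l : ℤ) : ((extensionShortComplex i p).map (step B l)).Exact := by
    refine step_map_exact _ l hf fun {T} z hz => ?_
    obtain h | h := le_or_gt (-(i + 1)) l
    · exact factors_of_W_eq_top (single_W_of_le _ h) z
    · rw [extension_W_of_lt i p (by lia), Subobject.bot_factors_iff_zero] at hz
      obtain rfl : z = 0 := (cancel_mono (extensionIncl i p).f).1 (hz.trans zero_comp.symm)
      exact Subobject.factors_zero
  have hstep' (l : ℤ) : Epi ((step B l).map (extensionProj i p)) := by
    obtain h | h := le_or_gt (-i) l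
    · exact epi_step_map _ (extension_W_of_le i p h)
    · exact ⟨fun _ _ _ => (isZero_step (single_W_of_lt V h)).eq_of_src _ _⟩
  have h₁ : ((extensionShortComplex i p).map (gr B k)).Exact :=
    exact_gr_map _ k comp_zero (hstep k) exact_map_of_epi
  have : Mono ((step B k).map (extensionShortComplex i p).f) :=
    inferInstanceAs (Mono ((step B k).map (extensionIncl i p)))
  have : Mono ((step B (k - 1)).map (extensionShortComplex i p).f) :=
    inferInstanceAs (Mono ((step B (k - 1)).map (extensionIncl i p)))
  have h₂ : Mono ((extensionShortComplex i p).map (gr B k)).f :=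
    mono_gr_map (extensionShortComplex i p).zero k (hstep (k - 1))
  have h₃ : Epi ((extensionShortComplex i p).map (gr B k)).g :=
    epi_gr_map k (extensionProj i p)
  -- Splitness costs nothing: in weight `-i` the sub has no graded piece, and in every other weight
  -- the quotient has none, so the remaining map is an isomorphism.
  by_cases hk : k = -i
  · have h : IsZero ((extensionShortComplex i p).map (gr B k)).X₁ := isZero_gr_single (by lia) _
    have := h₁.mono_g (h.eq_of_src _ _)
    exact ⟨.ofIsZeroOfIsIso _ h (isIso_of_mono_of_epi _)⟩
  · have h : IsZero ((extensionShortComplex i p).map (gr B k)).X₃ := isZero_gr_single hk _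
    have := h₁.epi_f (h.eq_of_tgt _ _)
    exact ⟨.ofIsIsoOfIsZero _ (isIso_of_mono_of_epi _) h⟩

/-! ### Induced filtrations on subobjects -/

/-- A subobject of a filtered object, with the induced filtration. -/
noncomputable def restrict (X : FilteredObject B) (S : Subobject X.obj) : FilteredObject B where
  obj := (S : B)
  W k := (Subobject.pullback S.arrow).obj (X.W k)
  monotone _ _ h := (Subobject.pullback _).monotone (X.monotone h)
  finite := by
    obtain ⟨N, hN⟩ := X.finite
    refine ⟨N, fun k hk => ?_⟩
    rw [(hN k hk).1, (hN k hk).2]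
    refine ⟨Subobject.pullback_top _, eq_bot_of_arrow ?_⟩
    have h := (pullback_factors_iff S.arrow (⊥ : Subobject X.obj) _).1 (Subobject.factors_self _)
    rw [Subobject.bot_factors_iff_zero] at h
    rw [← cancel_mono S.arrow, h, zero_comp]

section

variable (X : FilteredObject B) (S : Subobject X.obj)

lemma restrict_factors_iff {T : B} (k : ℤ) (f : T ⟶ (S : B)) :
    ((restrict X S).W k).Factors f ↔ (X.W k).Factors (f ≫ S.arrow) :=
  pullback_factors_iff _ _ _

/-- The inclusion of a subobject with the induced filtration. -/
noncomputable def restrictArrow : restrict X S ⟶ X where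
  f := S.arrow
  factors k := (restrict_factors_iff X S k _).1 (Subobject.factors_self _)

instance : Mono (restrictArrow X S).f := inferInstanceAs (Mono S.arrow)

instance : Mono (restrictArrow X S) where
  right_cancellation _ _ h := hom_ext ((cancel_mono (restrictArrow X S).f).1 (congr_arg Hom.f h))

variable {X S} in
/-- The factorization of a morphism through a subobject with the induced filtration. -/
noncomputable def restrictLift {Y : FilteredObject B} (f : Y ⟶ X) (hf : S.Factors f.f) :
    Y ⟶ restrict X S where
  f := S.factorThru f.f hf
  factors k := by
    have h : S.factorThru f.f hf ≫ S.arrow = f.f := Subobject.factorThru_arrow _ _ _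
    refine (restrict_factors_iff X S k _).2 ?_
    exact (congr_arg (X.W k).Factors ((assoc _ _ _).trans (congr_arg _ h))).mpr (f.factors k)

@[simp]
lemma restrictLift_arrow {Y : FilteredObject B} (f : Y ⟶ X) (hf : S.Factors f.f) :
    restrictLift f hf ≫ restrictArrow X S = f :=
  hom_ext (Subobject.factorThru_arrow _ _ hf)

end

end FilteredObject

/-! ### Detecting acyclicity and weak equivalences by `Hom(U, Gr^k -)` -/

namespace FilteredObject

section

variable (B : Type u) [Category.{v} B] [Abelian B]

/-- The functor `Hom(U, Gr k -)`. A sequence of filtered objects belongs to the exact structure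
if and only if its images by all these functors are short exact sequences. -/
noncomputable abbrev grHom (k : ℤ) (U : B) : FilteredObject B ⥤ AddCommGrpCat.{v} :=
  gr B k ⋙ preadditiveCoyoneda.obj (Opposite.op U)

/-- The functor induced by `grHom` on homotopy categories. -/
noncomputable abbrev grHomHomotopy (k : ℤ) (U : B) : BoundedHomotopyCategory (FilteredObject B) ⥤
    HomotopyCategory AddCommGrpCat.{v} (.up ℤ) :=
  (boundedHomotopy (FilteredObject B)).ι ⋙ (grHom B k U).mapHomotopyCategory (.up ℤ)

instance (k : ℤ) (U : B) : ((HomotopyCategory.subcategoryAcyclic AddCommGrpCat.{v}).inverseImage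
    (grHomHomotopy B k U)).IsStableUnderRetracts where
  of_retract {X Y} r h := by
    have h' := (HomotopyCategory.mem_subcategoryAcyclic_iff _).1 h
    refine (HomotopyCategory.mem_subcategoryAcyclic_iff _).2 (fun n => ?_)
    let r' := r.map (grHomHomotopy B k U ⋙ HomotopyCategory.homologyFunctor _ (.up ℤ) n)
    exact IsZero.of_mono r'.i (h' n)

/-- Split exact sequences remain exact under `Hom(U, -)`, and acyclicity after a functor passes to
cones, shifts and retracts. -/
lemma triangEnvelope_le_grHom (k : ℤ) (U : B) :
    (acyclicBounded (exactStructure B)).triangEnvelope ≤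
      (HomotopyCategory.subcategoryAcyclic AddCommGrpCat.{v}).inverseImage
        (grHomHomotopy B k U) := by
  rw [ObjectProperty.triangEnvelope_le_iff]
  intro K hK
  exact (HomotopyCategory.quotient_obj_mem_subcategoryAcyclic_iff_acyclic _).2
    (hK.acyclic_map (grHom B k U)
      (fun S hS => ((hS k).some.map (preadditiveCoyoneda.obj (Opposite.op U))).shortExact))

end

variable {B : Type u} [Category.{v} B] [Abelian B]

lemma exactAt_map_iff {D : Type u'} [Category.{v'} D] [Abelian D] {G : FilteredObject B ⥤ D}
    [G.Additive] (K : CochainComplex (FilteredObject B) ℤ) (m n : ℤ) (h : m + 1 = n) :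
    ((G.mapHomologicalComplex (.up ℤ)).obj K).ExactAt n ↔
      ((ShortComplex.mk (K.d m n) (K.d n (n + 1)) (K.d_comp_d _ _ _)).map G).Exact := by
  rw [HomologicalComplex.exactAt_iff' _ m n (n + 1) (by simp; lia) (by simp)]
  exact Iff.rfl

lemma exactAt_grHom_iff (k : ℤ) (U : B) (K : CochainComplex (FilteredObject B) ℤ) (m n : ℤ)
    (h : m + 1 = n) : (((grHom B k U).mapHomologicalComplex (.up ℤ)).obj K).ExactAt n ↔
      ∀ x : U ⟶ (gr B k).obj (K.X n), x ≫ (gr B k).map (K.d n (n + 1)) = 0 →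
        ∃ y, y ≫ (gr B k).map (K.d m n) = x := by
  rw [exactAt_map_iff K m n h, ShortComplex.ab_exact_iff]
  exact Iff.rfl

section

variable {K : CochainComplex (FilteredObject B) ℤ} {n : ℤ}

lemma exactAt_gr {k : ℤ}
    (h : ∀ U, (((grHom B k U).mapHomologicalComplex (.up ℤ)).obj K).ExactAt n) :
    (((gr B k).mapHomologicalComplex (.up ℤ)).obj K).ExactAt n := by
  rw [exactAt_map_iff K (n - 1) n (by lia)]
  refine exact_map_of_refinements (K.d_comp_d _ _ _) fun {A} x hx => ?_
  obtain ⟨y, rfl⟩ := (exactAt_grHom_iff k A K (n - 1) n (by lia)).1 (h A) x hx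
  exact ⟨A, 𝟙 A, inferInstance, y, id_comp _⟩

/-- Climb the filtration from a weight where the step in degree `n` is zero, adding one graded piece
at a time. -/
lemma exactAt_step_of_gr
    (h : ∀ k, (((gr B k).mapHomologicalComplex (.up ℤ)).obj K).ExactAt n) (k : ℤ) :
    (((step B k).mapHomologicalComplex (.up ℤ)).obj K).ExactAt n := by
  obtain ⟨N, hN⟩ := (K.X n).finite
  have h₀ (l : ℤ) (hl : l ≤ -N) : (((step B l).mapHomologicalComplex (.up ℤ)).obj K).ExactAt n := by
    rw [HomologicalComplex.exactAt_iff]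
    apply ShortComplex.exact_of_isZero_X₂
    exact isZero_step (by simpa using (hN (-l) (by lia)).2)
  obtain hk | hk := le_total k (-N)
  · exact h₀ k hk
  induction k, hk using Int.leInduction with
  | base => exact h₀ _ le_rfl
  | succ l _ ih => exact exactAt_step K n (l + 1) (by rwa [add_sub_cancel_right]) (h _)

end

section

variable (K : CochainComplex (FilteredObject B) ℤ) (n : ℤ)

/-- The cycles of a complex of filtered objects, with the induced filtration. -/
noncomputable abbrev filteredCycles : FilteredObject B :=
  restrict (K.X n) (kernelSubobject (K.d n (n + 1)).f)

/-- The inclusion of the cycles. -/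
noncomputable abbrev filteredICycles : filteredCycles K n ⟶ K.X n := restrictArrow _ _

lemma filteredICycles_d : filteredICycles K n ≫ K.d n (n + 1) = 0 :=
  hom_ext (kernelSubobject_arrow_comp (K.d n (n + 1)).f)

lemma cycles_step_exact (k : ℤ) :
    ((ShortComplex.mk _ _ (filteredICycles_d K n)).map (step B k)).Exact := by
  refine step_map_exact _ k ?_ fun z hz => (restrict_factors_iff _ _ _ _).2 hz
  refine ShortComplex.exact_of_f_is_kernel _ ?_
  exact IsLimit.ofIsoLimit (kernelIsKernel (K.d n (n + 1)).f)
    (Fork.ext (kernelSubobjectIso _).symm (kernelSubobject_arrow' _))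

instance mono_gr_filteredICycles (k : ℤ) : Mono ((gr B k).map (filteredICycles K n)) :=
  mono_gr_map (filteredICycles_d K n) k (cycles_step_exact K n (k - 1))

variable {K n}

/-- `Gr k` does not preserve kernels in general. Exactness of `W (k - 1)` in the next degree gives
the strictness of the differential that is needed here. -/
lemma cycles_gr_exact {k : ℤ}
    (h : (((step B (k - 1)).mapHomologicalComplex (.up ℤ)).obj K).ExactAt (n + 1)) :
    ((ShortComplex.mk _ _ (filteredICycles_d K n)).map (gr B k)).Exact :=
  exact_gr_map _ k (K.d_comp_d n (n + 1) (n + 1 + 1)) (cycles_step_exact K n k)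
    ((exactAt_map_iff K n (n + 1) rfl).1 h)

end

/-- The cycles with induced filtration serve as the objects `Z n`. Exactness after `Gr k` follows
from strictness, and exactness of `Hom(U, Gr k K)` for varying `U` provides the splittings. -/
lemma isAcyclicComplex_of_grHom {K : CochainComplex (FilteredObject B) ℤ}
    (h : ∀ k U, (((grHom B k U).mapHomologicalComplex (.up ℤ)).obj K).Acyclic) :
    IsAcyclicComplex (exactStructure B) K := by
  have hstep (k n : ℤ) : (((step B k).mapHomologicalComplex (.up ℤ)).obj K).ExactAt n :=
    exactAt_step_of_gr (fun l => exactAt_gr fun U => h l U n) k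
  let π (n : ℤ) : K.X n ⟶ filteredCycles K (n + 1) :=
    restrictLift (K.d n (n + 1)) ((kernelSubobject_factors_iff _ _).2
      (congr_arg Hom.f (K.d_comp_d n (n + 1) (n + 1 + 1))))
  have hπ (n : ℤ) : π n ≫ filteredICycles K (n + 1) = K.d n (n + 1) := restrictLift_arrow _ _ _ _
  have w (n : ℤ) : filteredICycles K n ≫ π n = 0 := by
    rw [← cancel_mono (filteredICycles K (n + 1)), assoc, hπ, filteredICycles_d, zero_comp]
  refine ⟨filteredCycles K, filteredICycles K, π, w, hπ, fun n k => ?_⟩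
  -- Take for `U` the object `Gr k` of the cycles in degree `n + 1`: their inclusion is a cocycle,
  -- and lifting it through the differential gives a section of `Gr k (π n)`.
  obtain ⟨σ, hσ⟩ := (exactAt_grHom_iff k _ K n (n + 1) rfl).1 (h k _ (n + 1))
    ((gr B k).map (filteredICycles K (n + 1)))
    (by rw [← Functor.map_comp, filteredICycles_d, Functor.map_zero])
  have hex : ((ShortComplex.mk _ _ (w n)).map (gr B k)).Exact := by
    refine exact_map_of_refinements (w n) fun {A} x hx => ?_
    refine exists_refinement_of_exact_map (filteredICycles_d K n) (cycles_gr_exact (hstep _ _)) x ?_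
    rw [← hπ, Functor.map_comp, reassoc_of% hx, zero_comp]
  refine ⟨.ofExactOfSection _ hex σ ?_ (mono_gr_filteredICycles K n k)⟩
  have : σ ≫ (gr B k).map (π n) = 𝟙 _ := by
    rw [← cancel_mono ((gr B k).map (filteredICycles K (n + 1))), assoc, ← Functor.map_comp, hπ,
      hσ, id_comp]
  exact this

/-- Apply the criterion for acyclicity to the cone of `s`. In particular the thick envelope contains
no more bounded complexes than the acyclic ones. -/
lemma trW_iff_grHom {K L : BoundedHomotopyCategory (FilteredObject B)} (s : K ⟶ L) :
    (acyclicBounded (exactStructure B)).triangEnvelope.trW s ↔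
      ∀ k U, HomotopyCategory.quasiIso AddCommGrpCat.{v} (.up ℤ) ((grHomHomotopy B k U).map s) := by
  have h (k : ℤ) (U : B) : HomotopyCategory.quasiIso AddCommGrpCat.{v} (.up ℤ)
      ((grHomHomotopy B k U).map s) ↔ ((HomotopyCategory.subcategoryAcyclic
        AddCommGrpCat.{v}).inverseImage (grHomHomotopy B k U)).trW s := by
    rw [ObjectProperty.inverseImage_trW_iff, HomotopyCategory.quasiIso_eq_trW_subcategoryAcyclic]
  simp only [h]
  refine ⟨fun hs k U => ObjectProperty.trW_monotone (triangEnvelope_le_grHom B k U) _ hs,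
    fun hs => ?_⟩
  obtain ⟨Z, g, δ, hT⟩ := distinguished_cocone_triangle s
  refine ObjectProperty.trW.mk _ hT (ObjectProperty.le_triangEnvelope _ _ ?_)
  obtain ⟨⟨Z⟩, hZ⟩ := Z
  refine isAcyclicComplex_of_grHom fun k U => ?_
  rw [← HomotopyCategory.quotient_obj_mem_subcategoryAcyclic_iff_acyclic]
  exact (ObjectProperty.trW_iff_of_distinguished _ _ hT).1 (hs k U)

end FilteredObject

/-! ### Canonical truncation in nonpositive degrees -/

section

variable {D : Type u} [Category.{v} D] [Abelian D] {K L : CochainComplex D ℤ} (φ : K ⟶ L)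

lemma HomologicalComplex.quasiIsoAt_of_epi_of_mono (n : ℤ) [Epi (φ.f (n - 1))] [Mono (φ.f n)]
    [Mono (φ.f (n + 1))]
    (h : ∀ {A : D} (y : A ⟶ L.X n), y ≫ L.d n (n + 1) = 0 → ∃ x, x ≫ φ.f n = y) :
    QuasiIsoAt φ n := by
  rw [quasiIsoAt_iff_isIso_homologyMap]
  have : Mono (homologyMap φ n) := by
    rw [mono_homologyMap_iff_up_to_refinements φ (n - 1) n (n + 1) (by simp) (by simp)]
    intro A x _ y hxy
    obtain ⟨A', π, _, x', hx'⟩ := surjective_up_to_refinements_of_epi (φ.f (n - 1)) y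
    refine ⟨A', π, inferInstance, x', ?_⟩
    rw [← cancel_mono (φ.f n), assoc, hxy, reassoc_of% hx', assoc, φ.comm]
  have : Epi (homologyMap φ n) := by
    rw [epi_homologyMap_iff_up_to_refinements φ (n - 1) n (n + 1) (by simp) (by simp)]
    intro A y hy
    obtain ⟨x, rfl⟩ := h y hy
    refine ⟨A, 𝟙 A, inferInstance, x, ?_, 0, by simp⟩
    rw [← cancel_mono (φ.f (n + 1)), zero_comp, ← hy, assoc, assoc, φ.comm]
  exact isIso_of_mono_of_epi _

variable {φ}

lemma HomologicalComplex.epi_f_of_quasiIsoAt {n : ℤ} [QuasiIsoAt φ n]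
    (h : L.d (n - 1) n = 0) (h' : L.d n (n + 1) = 0) : Epi (φ.f n) := by
  rw [epi_iff_surjective_up_to_refinements]
  intro A y
  obtain ⟨A', π, hπ, x, _, y', hx⟩ := (epi_homologyMap_iff_up_to_refinements φ (n - 1) n (n + 1)
    (by simp) (by simp)).1 inferInstance y (by rw [h', comp_zero])
  exact ⟨A', π, hπ, x, by rw [hx, h, comp_zero, add_zero]⟩

lemma HomologicalComplex.exact_of_quasiIsoAt {n : ℤ} [QuasiIsoAt φ n]
    (h : L.d (n - 1) n = 0) (h' : K.d n (n + 1) = 0) :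
    (ShortComplex.mk (K.d (n - 1) n) (φ.f n) (by rw [← φ.comm, h, comp_zero])).Exact := by
  rw [ShortComplex.exact_iff_exact_up_to_refinements]
  intro A x hx
  exact (mono_homologyMap_iff_up_to_refinements φ (n - 1) n (n + 1)
    (by simp) (by simp)).1 inferInstance x (by rw [h', comp_zero]) 0 (hx.trans zero_comp.symm)

end

namespace FilteredObject

variable {B : Type u} [Category.{v} B] [Abelian B]

lemma isZero_restrict {X : FilteredObject B} (S : Subobject X.obj) (h : IsZero X) :
    IsZero (restrict X S) :=
  IsZero.of_mono (restrictArrow X S) h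

lemma isZero_restrict_of_eq_bot {X : FilteredObject B} {S : Subobject X.obj} (h : S = ⊥) :
    IsZero (restrict X S) := by
  rw [IsZero.iff_id_eq_zero, ← cancel_mono (restrictArrow X S)]
  ext
  subst h
  change 𝟙 _ ≫ Subobject.arrow ⊥ = 0 ≫ Subobject.arrow ⊥
  rw [Subobject.bot_arrow, comp_zero, comp_zero]

lemma isIso_restrictArrow {X : FilteredObject B} {S : Subobject X.obj} (h : S = ⊤) :
    IsIso (restrictArrow X S) :=
  ⟨restrictLift (𝟙 X) (by rw [h]; exact Subobject.top_factors _),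
    by rw [← cancel_mono (restrictArrow X S), assoc, restrictLift_arrow, comp_id, id_comp],
    restrictLift_arrow _ _ _ _⟩

section

variable (K : CochainComplex (FilteredObject B) ℤ)

/-- The subobjects which define the canonical truncation in nonpositive degrees. -/
noncomputable def truncSubobject (n : ℤ) : Subobject (K.X n).obj :=
  if n < 0 then ⊤ else if n = 0 then kernelSubobject (K.d n (n + 1)).f else ⊥

variable {K} in
lemma truncSubobject_of_neg {n : ℤ} (h : n < 0) : truncSubobject K n = ⊤ := if_pos h

variable {K} in
lemma truncSubobject_of_pos {n : ℤ} (h : 0 < n) : truncSubobject K n = ⊥ := by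
  rw [truncSubobject, if_neg (by lia), if_neg (by lia)]

lemma truncSubobject_factors (i j : ℤ) :
    (truncSubobject K j).Factors (restrictArrow _ (truncSubobject K i) ≫ K.d i j).f := by
  by_cases hij : i + 1 = j
  · subst hij
    obtain hi | rfl | hi | hi : i + 1 < 0 ∨ i = -1 ∨ i = 0 ∨ 0 < i := by lia
    · rw [truncSubobject_of_neg hi]
      exact Subobject.top_factors _
    · refine (kernelSubobject_factors_iff (K.d (-1 + 1) (-1 + 1 + 1)).f _).2 ?_
      rw [← comp_f, assoc, K.d_comp_d, comp_zero, zero_f]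
    · subst hi
      have : restrictArrow _ (truncSubobject K 0) ≫ K.d 0 (0 + 1) = 0 := filteredICycles_d K 0
      rw [this]
      exact Subobject.factors_zero
    · have : restrictArrow _ (truncSubobject K i) = 0 :=
        (isZero_restrict_of_eq_bot (truncSubobject_of_pos hi)).eq_of_src _ _
      rw [this, zero_comp]
      exact Subobject.factors_zero
  · rw [K.shape _ _ hij, comp_zero]
    exact Subobject.factors_zero

/-- The canonical truncation of a complex of filtered objects in nonpositive degrees. -/
noncomputable def truncLEZero : CochainComplex (FilteredObject B) ℤ where
  X n := restrict (K.X n) (truncSubobject K n)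
  d i j := restrictLift (restrictArrow _ _ ≫ K.d i j) (truncSubobject_factors K i j)
  shape i j hij := by
    rw [← cancel_mono (restrictArrow _ _), restrictLift_arrow, K.shape _ _ hij, comp_zero,
      zero_comp]
  d_comp_d' i j k _ _ := by
    rw [← cancel_mono (restrictArrow _ _), assoc, restrictLift_arrow, ← assoc, restrictLift_arrow,
      assoc, K.d_comp_d, comp_zero, zero_comp]

/-- The inclusion of the canonical truncation. -/
noncomputable def truncLEZeroι : truncLEZero K ⟶ K where
  f _ := restrictArrow _ _
  comm' _ _ _ := (restrictLift_arrow _ _ _ _).symm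

variable {K}

lemma isZero_truncLEZero_X {n : ℤ} (h : IsZero (K.X n) ∨ 0 < n) : IsZero ((truncLEZero K).X n) :=
  h.elim (isZero_restrict _) fun h => isZero_restrict_of_eq_bot (truncSubobject_of_pos h)

/-- The only delicate degree is `0`, where `Hom(U, Gr k -)` of the filtered cycles has to be the
group of cocycles. This holds because exactness of `K` in degree `1` makes the differential leaving
degree `0` strict. -/
lemma quasiIso_grHom_truncLEZeroι
    (h : ∀ k U n, 0 < n → (((grHom B k U).mapHomologicalComplex (.up ℤ)).obj K).ExactAt n)
    (k : ℤ) (U : B) :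
    QuasiIso (((grHom B k U).mapHomologicalComplex (.up ℤ)).map (truncLEZeroι K)) := by
  let φ := ((grHom B k U).mapHomologicalComplex (.up ℤ)).map (truncLEZeroι K)
  have hiso (n : ℤ) (hn : n < 0) : IsIso (φ.f n) := by
    have : IsIso ((truncLEZeroι K).f n) := isIso_restrictArrow (truncSubobject_of_neg hn)
    exact inferInstanceAs (IsIso ((grHom B k U).map ((truncLEZeroι K).f n)))
  have hmono (n : ℤ) : Mono (φ.f n) := by
    obtain hn | rfl | hn := lt_trichotomy n 0
    · have := hiso n hn
      infer_instance
    · have := mono_gr_filteredICycles K 0 k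
      exact inferInstanceAs (Mono ((preadditiveCoyoneda.obj (Opposite.op U)).map
        ((gr B k).map (filteredICycles K 0))))
    · exact ⟨fun _ _ _ => ((grHom B k U).map_isZero (isZero_truncLEZero_X (.inr hn))).eq_of_tgt _ _⟩
  refine ⟨fun n => ?_⟩
  obtain hn | hn := lt_or_ge 0 n
  · rw [quasiIsoAt_iff_exactAt' _ _ (h k U n hn), HomologicalComplex.exactAt_iff]
    apply ShortComplex.exact_of_isZero_X₂
    exact (grHom B k U).map_isZero (isZero_truncLEZero_X (.inr hn))
  · have := hiso (n - 1) (by lia)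
    have := hmono n
    have := hmono (n + 1)
    refine HomologicalComplex.quasiIsoAt_of_epi_of_mono φ n fun {A} y hy => ?_
    obtain hn | rfl := hn.lt_or_eq
    · have := hiso n hn
      exact ⟨y ≫ inv (φ.f n), by simp⟩
    · have hex := cycles_gr_exact (K := K) (n := 0) (k := k) (exactAt_step_of_gr
        (fun l => exactAt_gr fun U => h l U _ (by lia)) _)
      have : Mono (((ShortComplex.mk _ _ (filteredICycles_d K 0)).map (gr B k)).f) :=
        mono_gr_filteredICycles K 0 k
      have hex' := hex.map_of_mono_of_preservesKernel (preadditiveCoyoneda.obj (Opposite.op U))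
        this inferInstance
      have : Mono (((ShortComplex.mk _ _ (filteredICycles_d K 0)).map (gr B k)).map
        (preadditiveCoyoneda.obj (Opposite.op U))).f := hmono 0
      exact ⟨hex'.lift y hy, hex'.lift_f y hy⟩

end

end FilteredObject

/-! ### Morphisms of `D^b(FB)` as fractions -/

namespace CategoryTheory.Localization

lemma exists_map_comp_eq_map {C : Type u} {D : Type u'} [Category.{v} C] [Category.{v'} D]
    (L : C ⥤ D) (W : MorphismProperty C) [L.IsLocalization W] [W.HasRightCalculusOfFractions]
    {X Y : C} (f : L.obj X ⟶ L.obj Y) :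
    ∃ (Z : C) (s : Z ⟶ X) (g : Z ⟶ Y), W s ∧ L.map s ≫ f = L.map g := by
  obtain ⟨φ, hφ⟩ := exists_rightFraction L W f
  exact ⟨_, φ.s, φ.f, φ.hs, by rw [hφ, MorphismProperty.RightFraction.map_s_comp_map]⟩

end CategoryTheory.Localization

namespace FilteredObject

variable {B : Type u} [Category.{v} B] [Abelian B]

section

variable {K : CochainComplex (FilteredObject B) ℤ}

/-- The property of being a bounded complex. -/
def IsBoundedComplex (K : CochainComplex (FilteredObject B) ℤ) : Prop :=
  ∃ a b : ℤ, ∀ n : ℤ, n < a ∨ b < n → IsZero (K.X n)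

lemma IsBoundedComplex.truncLEZero (hK : IsBoundedComplex K) :
    IsBoundedComplex (truncLEZero K) := by
  obtain ⟨a, b, h⟩ := hK
  exact ⟨a, b, fun n hn => isZero_truncLEZero_X (.inl (h n hn))⟩

/-- A bounded complex, as an object of the bounded homotopy category. -/
def boundedObj (K : CochainComplex (FilteredObject B) ℤ)
    (hK : IsBoundedComplex K) :
    BoundedHomotopyCategory (FilteredObject B) :=
  ⟨(HomotopyCategory.quotient _ _).obj K, hK⟩

/-- A morphism between bounded complexes, as a morphism in the bounded homotopy category. -/
def boundedMap {K L : CochainComplex (FilteredObject B) ℤ} (f : K ⟶ L)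
    (hK : IsBoundedComplex K)
    (hL : IsBoundedComplex L) :
    boundedObj K hK ⟶ boundedObj L hL :=
  ObjectProperty.homMk ((HomotopyCategory.quotient _ _).map f)

@[simp]
lemma boundedMap_zero {K L : CochainComplex (FilteredObject B) ℤ} (hK : IsBoundedComplex K)
    (hL : IsBoundedComplex L) : boundedMap (0 : K ⟶ L) hK hL = 0 := by
  ext
  exact (HomotopyCategory.quotient _ _).map_zero _ _

lemma boundedMap_comp {K L M : CochainComplex (FilteredObject B) ℤ} (f : K ⟶ L) (g : L ⟶ M)
    (hK : IsBoundedComplex K) (hL : IsBoundedComplex L) (hM : IsBoundedComplex M) :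
    boundedMap (f ≫ g) hK hM = boundedMap f hK hL ≫ boundedMap g hL hM := by
  ext
  exact (HomotopyCategory.quotient _ _).map_comp f g

lemma trW_boundedMap_iff {K L : CochainComplex (FilteredObject B) ℤ} (f : K ⟶ L)
    (hK : IsBoundedComplex K)
    (hL : IsBoundedComplex L) :
    (acyclicBounded (exactStructure B)).triangEnvelope.trW (boundedMap f hK hL) ↔
      ∀ k U, QuasiIso (((grHom B k U).mapHomologicalComplex (.up ℤ)).map f) := by
  rw [trW_iff_grHom]
  refine forall_congr' fun k => forall_congr' fun U => ?_
  exact HomotopyCategory.quotient_map_mem_quasiIso_iff _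

/-- The functor induced by `step` on homotopy categories. -/
noncomputable abbrev stepHomotopy (B : Type u) [Category.{v} B] [Abelian B] (k : ℤ) :
    BoundedHomotopyCategory (FilteredObject B) ⥤ HomotopyCategory B (.up ℤ) :=
  (boundedHomotopy (FilteredObject B)).ι ⋙ (step B k).mapHomotopyCategory (.up ℤ)

/-- Exactness of all `Hom(U, Gr l -)` gives exactness of all graded pieces, hence of all steps of
the filtration. -/
lemma triangEnvelope_le_step (k : ℤ) : (acyclicBounded (exactStructure B)).triangEnvelope ≤
    (HomotopyCategory.subcategoryAcyclic B).inverseImage (stepHomotopy B k) := by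
  rintro ⟨⟨K⟩, hK'⟩ hK
  refine (HomotopyCategory.quotient_obj_mem_subcategoryAcyclic_iff_acyclic _).2 fun n => ?_
  exact exactAt_step_of_gr (fun l => exactAt_gr fun U =>
    (HomotopyCategory.quotient_obj_mem_subcategoryAcyclic_iff_acyclic _).1
      (triangEnvelope_le_grHom B l U _ hK) n) k

lemma quasiIso_step_of_trW {K L : CochainComplex (FilteredObject B) ℤ} (f : K ⟶ L)
    {hK : IsBoundedComplex K}
    {hL : IsBoundedComplex L}
    (h : (acyclicBounded (exactStructure B)).triangEnvelope.trW (boundedMap f hK hL)) (k : ℤ) :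
    QuasiIso (((step B k).mapHomologicalComplex (.up ℤ)).map f) := by
  replace h := ObjectProperty.trW_monotone (triangEnvelope_le_step k) _ h
  rw [ObjectProperty.inverseImage_trW_iff,
    ← HomotopyCategory.quasiIso_eq_trW_subcategoryAcyclic] at h
  exact (HomotopyCategory.quotient_map_mem_quasiIso_iff _).1 h

lemma quasiIso_forget_of_trW {K L : CochainComplex (FilteredObject B) ℤ} (f : K ⟶ L)
    {hK : IsBoundedComplex K}
    {hL : IsBoundedComplex L}
    (h : (acyclicBounded (exactStructure B)).triangEnvelope.trW (boundedMap f hK hL)) :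
    QuasiIso (((forget B).mapHomologicalComplex (.up ℤ)).map f) := by
  replace h := ObjectProperty.trW_monotone (acyclic_le B) _ h
  rw [ObjectProperty.inverseImage_trW_iff,
    ← HomotopyCategory.quasiIso_eq_trW_subcategoryAcyclic] at h
  exact (HomotopyCategory.quotient_map_mem_quasiIso_iff _).1 h

lemma single_bounded (m : ℤ) (X : FilteredObject B) :
    IsBoundedComplex ((CochainComplex.singleFunctor (FilteredObject B) m).obj X) :=
  ⟨m, m, fun n hn => HomologicalComplex.isZero_single_obj_X (.up ℤ) m X n (by lia)⟩

/-- A filtered object placed in a given degree, in the bounded homotopy category. -/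
noncomputable abbrev boundedSingle (m : ℤ) (X : FilteredObject B) :
    BoundedHomotopyCategory (FilteredObject B) :=
  boundedObj _ (single_bounded m X)

end

namespace DerivedBounded

open BoundedDerivedCategory

/-- The functor `FB ⥤ D^b(FB)`. -/
noncomputable abbrev ofFiltered : FilteredObject B ⥤ DerivedBounded B :=
  BoundedDerivedCategory.single (exactStructure B)

/-- The object `X[n]` of the bounded derived category is `X` placed in degree `-n`. -/
noncomputable def shiftIso (X : FilteredObject B) (n : ℤ) :
    (ofFiltered.obj X)⟦n⟧ ≅ (Qh (exactStructure B)).obj (boundedSingle (-n) X) :=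
  (((Qh (exactStructure B)).commShiftIso n).app _).symm ≪≫
    (Qh (exactStructure B)).mapIso ((boundedHomotopy (FilteredObject B)).fullyFaithfulι.preimageIso
      (((boundedHomotopy (FilteredObject B)).ι.commShiftIso n).app _ ≪≫
        ((HomotopyCategory.singleFunctors (FilteredObject B)).shiftIso n (-n) 0 (by simp)).app X))

lemma exists_fraction {X Y : FilteredObject B} {m : ℤ}
    (f : (Qh (exactStructure B)).obj (boundedSingle 0 X) ⟶
      (Qh (exactStructure B)).obj (boundedSingle m Y)) :
    ∃ (K : CochainComplex (FilteredObject B) ℤ) (hK : IsBoundedComplex K)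
      (s : K ⟶ (CochainComplex.singleFunctor (FilteredObject B) 0).obj X)
      (g : K ⟶ (CochainComplex.singleFunctor (FilteredObject B) m).obj Y),
      (acyclicBounded (exactStructure B)).triangEnvelope.trW
        (boundedMap s hK (single_bounded 0 X)) ∧
      (Qh (exactStructure B)).map (boundedMap s hK (single_bounded 0 X)) ≫ f =
        (Qh (exactStructure B)).map (boundedMap g hK (single_bounded m Y)) := by
  obtain ⟨⟨⟨K⟩, hK⟩, s, g, hs, hsg⟩ := Localization.exists_map_comp_eq_map
    (Qh (exactStructure B)) (acyclicBounded (exactStructure B)).triangEnvelope.trW f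
  obtain ⟨s, rfl⟩ : ∃ s', s = boundedMap s' hK (single_bounded 0 X) := by
    obtain ⟨s', hs'⟩ := (HomotopyCategory.quotient _ _).map_surjective s.hom
    exact ⟨s', by ext; exact hs'.symm⟩
  obtain ⟨g, rfl⟩ : ∃ g', g = boundedMap g' hK (single_bounded m Y) := by
    obtain ⟨g', hg'⟩ := (HomotopyCategory.quotient _ _).map_surjective g.hom
    exact ⟨g', by ext; exact hg'.symm⟩
  exact ⟨K, hK, s, g, hs, hsg⟩

/-- The roof of a fraction is weakly equivalent to `X` in degree `0`, so it is exact in positive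
degrees after each `Hom(U, Gr k -)` and may be replaced by its truncation. -/
lemma exists_fraction_of_nonpos {X Y : FilteredObject B} {m : ℤ}
    (f : (Qh (exactStructure B)).obj (boundedSingle 0 X) ⟶
      (Qh (exactStructure B)).obj (boundedSingle m Y)) :
    ∃ (K : CochainComplex (FilteredObject B) ℤ) (hK : IsBoundedComplex K)
      (s : K ⟶ (CochainComplex.singleFunctor (FilteredObject B) 0).obj X)
      (g : K ⟶ (CochainComplex.singleFunctor (FilteredObject B) m).obj Y),
      (∀ n, 0 < n → IsZero (K.X n)) ∧
      (acyclicBounded (exactStructure B)).triangEnvelope.trW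
        (boundedMap s hK (single_bounded 0 X)) ∧
      (Qh (exactStructure B)).map (boundedMap s hK (single_bounded 0 X)) ≫ f =
        (Qh (exactStructure B)).map (boundedMap g hK (single_bounded m Y)) := by
  obtain ⟨K, hK, s, g, hs, hsg⟩ := exists_fraction f
  have hι : (acyclicBounded (exactStructure B)).triangEnvelope.trW
      (boundedMap (truncLEZeroι K) hK.truncLEZero hK) := by
    rw [trW_boundedMap_iff]
    refine quasiIso_grHom_truncLEZeroι fun k U n hn => ?_
    have := (trW_boundedMap_iff s hK (single_bounded 0 X)).1 hs k U
    rw [exactAt_iff_of_quasiIsoAt (((grHom B k U).mapHomologicalComplex (.up ℤ)).map s),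
      HomologicalComplex.exactAt_iff]
    apply ShortComplex.exact_of_isZero_X₂
    exact (grHom B k U).map_isZero
      (HomologicalComplex.isZero_single_obj_X (.up ℤ) 0 X n hn.ne')
  refine ⟨truncLEZero K, hK.truncLEZero, truncLEZeroι K ≫ s, truncLEZeroι K ≫ g,
    fun n hn => isZero_truncLEZero_X (.inr hn), ?_, ?_⟩
  · rw [boundedMap_comp _ _ _ hK]
    exact MorphismProperty.comp_mem _ _ _ hι hs
  · rw [boundedMap_comp _ _ _ hK, boundedMap_comp _ _ _ hK, Functor.map_comp, Functor.map_comp,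
      ← hsg, assoc]

variable {X Y : FilteredObject B} {n : ℤ}

lemma isIso_Qh_map {K L : CochainComplex (FilteredObject B) ℤ} {s : K ⟶ L}
    {hK : IsBoundedComplex K} {hL : IsBoundedComplex L}
    (hs : (acyclicBounded (exactStructure B)).triangEnvelope.trW (boundedMap s hK hL)) :
    IsIso ((Qh (exactStructure B)).map (boundedMap s hK hL)) :=
  Localization.inverts (Qh (exactStructure B))
    (acyclicBounded (exactStructure B)).triangEnvelope.trW _ hs

/-- The roof lives in degrees `≤ 0` and `Y[n]` in degree `-n > 0`, so the numerator of the fraction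
is zero. -/
lemma hom_shift_eq_zero (hn : n < 0) (f : ofFiltered.obj X ⟶ (ofFiltered.obj Y)⟦n⟧) : f = 0 := by
  obtain ⟨K, hK, s, g, hK', hs, hsg⟩ := exists_fraction_of_nonpos (f ≫ (shiftIso Y n).hom)
  obtain rfl : g = 0 := by
    apply HomologicalComplex.to_single_hom_ext
    exact (hK' _ (by lia)).eq_of_src _ _
  have := isIso_Qh_map hs
  rw [boundedMap_zero, Functor.map_zero] at hsg
  have h' := (cancel_epi _).1 (hsg.trans comp_zero.symm)
  exact (cancel_mono (shiftIso Y n).hom).1 (h'.trans zero_comp.symm)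

end DerivedBounded

end FilteredObject

/-! ### Morphisms between a complex and an object in a single degree -/

section

variable {C : Type u} {D : Type u'} [Category.{v} C] [Category.{v'} D] [Preadditive C]
  [HasZeroObject C] {K : CochainComplex C ℤ} {X : C} {m : ℤ}

/-- The degree `m` component of the complex `X` placed in degree `m` is `X`. -/
noncomputable def CochainComplex.singleXSelf (X : C) (m : ℤ) :
    ((CochainComplex.singleFunctor C m).obj X).X m ≅ X :=
  HomologicalComplex.singleObjXSelf (.up ℤ) m X

lemma CochainComplex.single_d_eq_zero (X : C) (m i j : ℤ) :
    ((singleFunctor C m).obj X).d i j = 0 :=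
  HomologicalComplex.single_obj_d (.up ℤ) m X i j

/-- The degree `m` component of a morphism to the complex `X` placed in degree `m`. -/
noncomputable def CochainComplex.toSingleComponent
    (s : K ⟶ (CochainComplex.singleFunctor C m).obj X) : K.X m ⟶ X :=
  s.f m ≫ (singleXSelf X m).hom

lemma CochainComplex.d_toSingleComponent
    (s : K ⟶ (CochainComplex.singleFunctor C m).obj X) (i : ℤ) :
    K.d i m ≫ toSingleComponent s = 0 := by
  rw [toSingleComponent, ← s.comm_assoc, single_d_eq_zero, zero_comp, comp_zero]

lemma CochainComplex.toSingle_hom_ext {s t : K ⟶ (CochainComplex.singleFunctor C m).obj X}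
    (h : toSingleComponent s = toSingleComponent t) : s = t :=
  HomologicalComplex.to_single_hom_ext ((cancel_mono (singleXSelf X m).hom).1 h)

lemma CochainComplex.toSingleComponent_comp_map
    (s : K ⟶ (CochainComplex.singleFunctor C m).obj X) {Y : C} (a : X ⟶ Y) :
    toSingleComponent (s ≫ (singleFunctor C m).map a) = toSingleComponent s ≫ a := by
  have h : ((singleFunctor C m).map a).f m ≫ (singleXSelf Y m).hom = (singleXSelf X m).hom ≫ a :=
    (congr_arg (· ≫ (singleXSelf Y m).hom)
      (HomologicalComplex.single_map_f_self (.up ℤ) m a)).trans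
      ((assoc _ _ _).trans (by
        refine congr_arg _ ((assoc _ _ _).trans ?_)
        exact (congr_arg _ (singleXSelf Y m).inv_hom_id).trans (comp_id _)))
  rw [toSingleComponent, toSingleComponent, HomologicalComplex.comp_f, assoc, h, assoc]

/-- The morphism from the complex `K.X m` placed in degree `m` to `K`, if the differential
starting from `K.X m` vanishes. -/
noncomputable def CochainComplex.fromSingle (hd : K.d m (m + 1) = 0) :
    (CochainComplex.singleFunctor C m).obj (K.X m) ⟶ K :=
  HomologicalComplex.mkHomFromSingle (𝟙 _) (by rintro _ rfl; rw [hd, comp_zero])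

lemma CochainComplex.fromSingle_comp (hd : K.d m (m + 1) = 0)
    (s : K ⟶ (CochainComplex.singleFunctor C m).obj X) :
    fromSingle hd ≫ s = (CochainComplex.singleFunctor C m).map (toSingleComponent s) := by
  apply HomologicalComplex.from_single_hom_ext
  have h : (fromSingle hd).f m = (singleXSelf _ m).hom :=
    (HomologicalComplex.mkHomFromSingle_f _ _).trans (comp_id _)
  rw [HomologicalComplex.comp_f, h]
  refine Eq.trans ?_ (HomologicalComplex.single_map_f_self (.up ℤ) m _).symm
  refine congr_arg _ ((comp_id _).symm.trans ?_)
  exact (congr_arg _ (singleXSelf X m).hom_inv_id.symm).trans (assoc _ _ _).symm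

variable [Abelian D] (F : C ⥤ D) [F.Additive]

lemma CochainComplex.single_map_d_eq_zero (i j : ℤ) :
    ((F.mapHomologicalComplex (.up ℤ)).obj ((singleFunctor C m).obj X)).d i j = 0 :=
  (congr_arg F.map (single_d_eq_zero X m i j)).trans (F.map_zero _ _)

lemma CochainComplex.epi_map_toSingleComponent
    (s : K ⟶ (CochainComplex.singleFunctor C m).obj X)
    [QuasiIso ((F.mapHomologicalComplex (.up ℤ)).map s)] :
    Epi (F.map (toSingleComponent s)) := by
  have : Epi (F.map (s.f m)) :=
    HomologicalComplex.epi_f_of_quasiIsoAt (φ := (F.mapHomologicalComplex (.up ℤ)).map s)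
      (single_map_d_eq_zero F _ _) (single_map_d_eq_zero F _ _)
  rw [toSingleComponent, F.map_comp]
  exact epi_comp _ _

lemma CochainComplex.exact_map_toSingleComponent
    (s : K ⟶ (CochainComplex.singleFunctor C m).obj X)
    [QuasiIso ((F.mapHomologicalComplex (.up ℤ)).map s)] (hd : K.d m (m + 1) = 0) :
    ((ShortComplex.mk _ _ (d_toSingleComponent s (m - 1))).map F).Exact := by
  have h := HomologicalComplex.exact_of_quasiIsoAt (n := m)
    (φ := (F.mapHomologicalComplex (.up ℤ)).map s)
    (single_map_d_eq_zero F _ _) ((congr_arg F.map hd).trans (F.map_zero _ _))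
  refine ShortComplex.exact_of_iso ?_ h
  refine ShortComplex.isoMk (Iso.refl _) (Iso.refl _) (F.mapIso (singleXSelf X m)) ?_ ?_
  · exact (id_comp _).trans (comp_id _).symm
  · exact (id_comp _).trans (F.map_comp _ _)

end

lemma CategoryTheory.Subobject.factors_of_epi_comp {C : Type u} [Category.{v} C] [Abelian C]
    {S T Y : C} {P : Subobject Y} (q : S ⟶ T) [Epi q] {f : T ⟶ Y} (h : P.Factors (q ≫ f)) :
    P.Factors f := by
  have sq : CommSq (P.factorThru _ h) q P.arrow f := ⟨P.factorThru_arrow _ h⟩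
  have := strongEpi_of_epi q
  rw [← sq.fac_right]
  exact factors_comp_arrow _

/-! ### Fullness of `FB ⥤ D^b(FB)` -/

namespace FilteredObject

variable {B : Type u} [Category.{v} B] [Abelian B]

namespace DerivedBounded

open BoundedDerivedCategory CochainComplex

/-- For a roof `K` in degrees `≤ 0`, the sequence `K⁻¹ ⟶ K⁰ ⟶ X ⟶ 0` is exact in `B`, so the degree
`0` component of the numerator descends to a morphism `a : X ⟶ Y` of underlying objects. -/
lemma exists_ofFiltered_map_eq {X Y : FilteredObject B}
    (f : (Qh (exactStructure B)).obj (boundedSingle 0 X) ⟶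
      (Qh (exactStructure B)).obj (boundedSingle 0 Y)) :
    ∃ a : X ⟶ Y, (Qh (exactStructure B)).map (boundedMap
      ((CochainComplex.singleFunctor _ 0).map a) (single_bounded 0 X) (single_bounded 0 Y)) =
        f := by
  obtain ⟨K, hK, s, g, hK', hs, hsg⟩ := exists_fraction_of_nonpos f
  have hd : K.d 0 (0 + 1) = 0 := (hK' _ (by lia)).eq_of_tgt _ _
  have := quasiIso_forget_of_trW s hs
  have hepi : Epi (toSingleComponent s).f := epi_map_toSingleComponent (forget B) s
  have hex := exact_map_toSingleComponent (forget B) s hd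
  have : Epi ((ShortComplex.mk _ _ (d_toSingleComponent s (0 - 1))).map (forget B)).g := hepi
  let a := hex.desc (toSingleComponent g).f (by
    exact congr_arg (forget B).map (d_toSingleComponent g (0 - 1)))
  have ha : (toSingleComponent s).f ≫ a = (toSingleComponent g).f := hex.g_desc _ _
  -- `a` respects the filtrations because `W k K⁰ ⟶ W k X` is also an epimorphism, so compatibility
  -- can be checked on `K⁰`.
  let α : X ⟶ Y := ⟨a, fun k => by
    have := quasiIso_step_of_trW s hs k
    have : Epi ((step B k).map (toSingleComponent s)) := epi_map_toSingleComponent (step B k) s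
    refine Subobject.factors_of_epi_comp ((step B k).map (toSingleComponent s)) ?_
    have h := (congr_arg (· ≫ a) ((stepArrow B k).naturality (toSingleComponent s))).trans
      ((assoc _ _ _).trans (congr_arg _ ha))
    exact (congr_arg _ ((assoc _ _ _).symm.trans h)).mpr ((toSingleComponent g).factors k)⟩
  have hα : s ≫ (CochainComplex.singleFunctor _ 0).map α = g :=
    toSingle_hom_ext (by rw [toSingleComponent_comp_map]; exact hom_ext ha)
  have := isIso_Qh_map hs
  refine ⟨α, ?_⟩
  rw [← cancel_epi ((Qh (exactStructure B)).map (boundedMap s hK _)), hsg, ← Functor.map_comp,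
    ← boundedMap_comp, hα]

instance : (ofFiltered (B := B)).Full where
  map_surjective f := exists_ofFiltered_map_eq f

end DerivedBounded

end FilteredObject

/-! ### Cones of short sequences of complexes in an additive category -/

lemma CategoryTheory.Pretriangulated.mk_comp_mem_distTriang {D : Type u} [Category.{v} D]
    [Preadditive D] [HasZeroObject D] [HasShift D ℤ] [∀ n : ℤ, (shiftFunctor D n).Additive]
    [Pretriangulated D] {T : Triangle D} (hT : T ∈ distTriang D) {Z : D} (z : T.obj₃ ⟶ Z)
    (_ : IsIso z) :
    Triangle.mk T.mor₁ (T.mor₂ ≫ z) (CategoryTheory.inv z ≫ T.mor₃) ∈ distTriang D :=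
  isomorphic_distinguished _ hT _ (Triangle.isoMk _ _ (Iso.refl _) (Iso.refl _) (asIso z).symm
    ((comp_id _).trans (id_comp _).symm)
    ((assoc _ _ _).trans ((congr_arg _ (IsIso.hom_inv_id z)).trans
      ((comp_id _).trans (id_comp _).symm)))
    ((congr_arg _ ((shiftFunctor D (1 : ℤ)).map_id _)).trans (comp_id _)))

namespace CochainComplex.mappingCone

variable {C : Type u} {D : Type u'} [Category.{v} C] [Category.{v'} D] [Preadditive C]
  [HasBinaryBiproducts C] [Abelian D] (S : ShortComplex (CochainComplex C ℤ))

/-- The canonical morphism from the mapping cone of `S.f` to `S.X₃`, for a short complex `S`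
of cochain complexes in an additive category. -/
noncomputable def toX₃ : mappingCone S.f ⟶ S.X₃ := desc S.f 0 S.g (by simp)

lemma inr_toX₃ : inr S.f ≫ toX₃ S = S.g := by simp [toX₃]

lemma mapHomologicalComplexIso_hom_descShortComplex_eq (F : C ⥤ D) [F.Additive] :
    (mapHomologicalComplexIso _ _).hom ≫
      descShortComplex (S.map (F.mapHomologicalComplex (.up ℤ))) =
    (F.mapHomologicalComplex (.up ℤ)).map (toX₃ S) := by
  ext n
  have h₁ := inl_v_descShortComplex_f (S.map (F.mapHomologicalComplex (.up ℤ))) (n + 1) n (by lia)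
  have h₂ := inr_f_descShortComplex_f (S.map (F.mapHomologicalComplex (.up ℤ))) n
  have h₃ : (toX₃ S).f n = (snd S.f).v n n (add_zero n) ≫ S.g.f n := by
    simp [toX₃, desc_f _ _ _ _ n (n + 1) rfl]
  have h₄ : (mapHomologicalComplexIso S.f F).hom.f n =
      (mapHomologicalComplexXIso' S.f F n (n + 1) rfl).hom :=
    congr_arg Iso.hom (mapHomologicalComplexXIso_eq S.f F n (n + 1) rfl)
  refine (congr_arg (· ≫ (descShortComplex (S.map (F.mapHomologicalComplex (.up ℤ)))).f n)
    (h₄.trans (mapHomologicalComplexXIso'_hom _ _ _ _ _))).trans ?_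
  refine (Preadditive.add_comp _ _ _ _ _ _).trans ?_
  refine (congr_arg₂ (· + ·) ((assoc _ _ _).trans ((congr_arg _ h₁).trans comp_zero))
    ((assoc _ _ _).trans (congr_arg _ h₂))).trans ((zero_add _).trans ?_)
  exact (F.map_comp _ _).symm.trans (congr_arg F.map h₃.symm)

/-- `C` need not be abelian, so the statement is tested in `D`: `F` commutes with mapping cones and
carries `toX₃` to the usual comparison map of a short exact sequence. -/
lemma quasiIso_map_toX₃ (F : C ⥤ D) [F.Additive]
    (h : (S.map (F.mapHomologicalComplex (.up ℤ))).ShortExact) :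
    QuasiIso ((F.mapHomologicalComplex (.up ℤ)).map (toX₃ S)) := by
  rw [← mapHomologicalComplexIso_hom_descShortComplex_eq]
  have h₁ : QuasiIso (mapHomologicalComplexIso S.f F).hom := inferInstance
  exact (HomologicalComplex.quasiIso D (.up ℤ)).comp_mem _ _ h₁ (quasiIso_descShortComplex h)

end CochainComplex.mappingCone

/-! ### Effacement and distinguished triangles in `D^b(FB)` -/

namespace FilteredObject

variable {B : Type u} [Category.{v} B] [Abelian B]

/-- The projections `extensionProj` are cofinal among morphisms to `V{i}` that split on `Gr (-i)`.
Take for `E` the elements of `W (-i) X` whose class in `Gr (-i) X` lies in the image of `σ`. Those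
mapping to `0` in `V` have class `0`, so they lie in `W (-i - 1) X`, as the filtration of `extension
i p` requires. -/
lemma exists_extension_comp_eq {X : FilteredObject B} {i : ℤ} {V : B} (q : X ⟶ single i V)
    {σ : (gr B (-i)).obj (single i V) ⟶ (gr B (-i)).obj X}
    (hσ : σ ≫ (gr B (-i)).map q = 𝟙 _) :
    ∃ (E : B) (p : E ⟶ V) (_ : Epi p) (h : extension i p ⟶ X), h ≫ q = extensionProj i p := by
  let V₀ := single i V
  have h₁ : IsIso ((stepArrow B (-i)).app V₀) := isIso_stepArrow (single_W_of_le _ le_rfl)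
  have h₂ : IsIso ((stepProj B (-i)).app V₀) := by
    have : Mono ((stepProj B (-i)).app V₀) :=
      (step_shortExact (-i) V₀).exact.mono_g
        ((isZero_step (single_W_of_lt V (by lia))).eq_of_src _ _)
    exact isIso_of_mono_of_epi _
  let a := pullback.fst ((stepProj B (-i)).app X) σ
  let b := pullback.snd ((stepProj B (-i)).app X) σ
  have hab : a ≫ (stepProj B (-i)).app X = b ≫ σ := pullback.condition
  have hb : a ≫ (step B (-i)).map q ≫ (stepProj B (-i)).app V₀ = b := by
    rw [(stepProj B (-i)).naturality, reassoc_of% hab, hσ, comp_id]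
  let f := a ≫ (stepArrow B (-i)).app X
  let p : pullback ((stepProj B (-i)).app X) σ ⟶ (forget B).obj V₀ := f ≫ (forget B).map q
  have hp : p = b ≫ inv ((stepProj B (-i)).app V₀) ≫ (stepArrow B (-i)).app V₀ := by
    rw [← hb, assoc, assoc, IsIso.hom_inv_id_assoc, (stepArrow B (-i)).naturality]
    exact assoc _ _ _
  have hepi : Epi p := by
    rw [hp]
    infer_instance
  -- `p` is `b` followed by the isomorphism from `Gr (-i)` of `V{i}` to `V`, so both have the same
  -- kernel.
  have hk : kernel.ι p ≫ b = 0 := by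
    rw [← cancel_mono (inv ((stepProj B (-i)).app V₀) ≫ (stepArrow B (-i)).app V₀), zero_comp,
      assoc, ← hp, kernel.condition]
  obtain ⟨x, hx⟩ := exists_step_lift (-i) (kernel.ι p ≫ a) (by
    rw [assoc, hab, reassoc_of% hk, zero_comp])
  refine ⟨_, p, hepi, homOfExtension i p f (Subobject.factors_comp_arrow _) ?_, rfl⟩
  have hf : kernel.ι p ≫ f = x ≫ (stepArrow B (-i - 1)).app X := by
    rw [← assoc, hx, assoc]
    exact congr_arg _ (stepInclApp_arrow (-i) X)
  exact (congr_arg (X.W (-i - 1)).Factors hf).mpr (Subobject.factors_comp_arrow _)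

namespace DerivedBounded

open BoundedDerivedCategory CochainComplex

/-- The filtered analogue of the effacement in `D^b(B)`: `q` is the map `K⁰ ⟶ X` from the degree `0`
term of a roof. It splits on graded pieces because the identity of `Gr k X` lifts under `Hom(Gr k X,
Gr k -)`. -/
lemma exists_map_comp_eq_zero {X Y : FilteredObject B} {m : ℤ} (hm : m < 0)
    (f : (Qh (exactStructure B)).obj (boundedSingle 0 X) ⟶
      (Qh (exactStructure B)).obj (boundedSingle m Y)) :
    ∃ (X' : FilteredObject B) (q : X' ⟶ X),
      (∀ k, ∃ σ, σ ≫ (gr B k).map q = 𝟙 _) ∧ (Qh (exactStructure B)).map (boundedMap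
        ((CochainComplex.singleFunctor _ 0).map q) (single_bounded 0 X') (single_bounded 0 X)) ≫
          f = 0 := by
  obtain ⟨K, hK, s, g, hK', hs, hsg⟩ := exists_fraction_of_nonpos f
  have hd : K.d 0 (0 + 1) = 0 := (hK' _ (by lia)).eq_of_tgt _ _
  refine ⟨K.X 0, toSingleComponent s, fun k => ?_, ?_⟩
  · have := (trW_boundedMap_iff s hK (single_bounded 0 X)).1 hs k ((gr B k).obj X)
    have := epi_map_toSingleComponent (grHom B k ((gr B k).obj X)) s
    exact (AddCommGrpCat.epi_iff_surjective _).1 this (𝟙 _)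
  · have hg : fromSingle hd ≫ g = 0 := HomologicalComplex.from_single_hom_ext
      ((HomologicalComplex.isZero_single_obj_X (.up ℤ) m Y 0 hm.ne').eq_of_tgt _ _)
    rw [← fromSingle_comp hd s, boundedMap_comp _ _ _ hK, Functor.map_comp, assoc, hsg,
      ← Functor.map_comp, ← boundedMap_comp, hg, boundedMap_zero, Functor.map_zero]

lemma exists_epi_comp_eq_zero {i : ℤ} {V : B} {Y : FilteredObject B} {n : ℤ} (hn : 0 < n)
    (f : ofFiltered.obj (single i V) ⟶ (ofFiltered.obj Y)⟦n⟧) :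
    ∃ (E : B) (p : E ⟶ V) (_ : Epi p), ofFiltered.map (extensionProj i p) ≫ f = 0 := by
  obtain ⟨X', q, hq, hf⟩ := exists_map_comp_eq_zero (by lia) (f ≫ (shiftIso Y n).hom)
  obtain ⟨σ, hσ⟩ := hq (-i)
  obtain ⟨E, p, hp, h, hpq⟩ := exists_extension_comp_eq q hσ
  refine ⟨E, p, hp, ?_⟩
  have hf' : ofFiltered.map q ≫ f = 0 := by
    rw [← cancel_mono (shiftIso Y n).hom, zero_comp, assoc]
    exact hf
  rw [← hpq, Functor.map_comp, assoc, hf', comp_zero]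

end DerivedBounded

/-- A short complex of filtered objects, placed in degree `0`. -/
noncomputable abbrev singleShortComplex (S : ShortComplex (FilteredObject B)) :
    ShortComplex (CochainComplex (FilteredObject B) ℤ) :=
  S.map (CochainComplex.singleFunctor (FilteredObject B) 0)

lemma quasiIso_grHom_toX₃ {S : ShortComplex (FilteredObject B)}
    (hS : exactStructure B S) (k : ℤ) (U : B) :
    QuasiIso (((grHom B k U).mapHomologicalComplex (.up ℤ)).map
      (CochainComplex.mappingCone.toX₃ (singleShortComplex S))) := by
  have h : (S.map (grHom B k U)).ShortExact :=
    ((hS k).some.map (preadditiveCoyoneda.obj (Opposite.op U))).shortExact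
  have h' : ((singleShortComplex S).map
      ((grHom B k U).mapHomologicalComplex (.up ℤ))).ShortExact :=
    ShortComplex.shortExact_of_iso
      (S.mapNatIso (HomologicalComplex.singleMapHomologicalComplex (grHom B k U) (.up ℤ) 0)).symm
      (h.map_of_exact (HomologicalComplex.single _ (.up ℤ) 0))
  exact CochainComplex.mappingCone.quasiIso_map_toX₃ _ _ h'

/-- Any cone `Z` of `S.f` is isomorphic to the mapping cone, whose canonical map to `S.X₃` is a weak
equivalence by `quasiIso_grHom_toX₃`; hence `S` gives a triangle after localization. -/
lemma exists_trW_comp_eq {S : ShortComplex (FilteredObject B)} (hS : exactStructure B S)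
    {Z : BoundedHomotopyCategory (FilteredObject B)} {g : boundedSingle 0 S.X₂ ⟶ Z}
    {δ : Z ⟶ (boundedSingle 0 S.X₁)⟦(1 : ℤ)⟧}
    (hT : Triangle.mk (boundedMap ((CochainComplex.singleFunctor _ 0).map S.f)
      (single_bounded 0 S.X₁) (single_bounded 0 S.X₂)) g δ ∈ distTriang _) :
    ∃ z : Z ⟶ boundedSingle 0 S.X₃, (acyclicBounded (exactStructure B)).triangEnvelope.trW z ∧
      g ≫ z = boundedMap ((CochainComplex.singleFunctor _ 0).map S.g)
        (single_bounded 0 S.X₂) (single_bounded 0 S.X₃) := by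
  let Q := HomotopyCategory.quotient (FilteredObject B) (.up ℤ)
  let ι := (boundedHomotopy (FilteredObject B)).ι
  let c := CochainComplex.mappingCone.toX₃ (singleShortComplex S)
  let e := isoTriangleOfIso₁₂ _ _ (ι.map_distinguished _ hT)
    (HomotopyCategory.mappingCone_triangleh_distinguished (singleShortComplex S).f)
    (Iso.refl _) (Iso.refl _) ((comp_id _).trans (id_comp _).symm)
  let e₃ : Z.obj ≅ Q.obj (CochainComplex.mappingCone (singleShortComplex S).f) :=
    Triangle.π₃.mapIso e
  have he : g.hom ≫ e₃.hom = Q.map (CochainComplex.mappingCone.inr (singleShortComplex S).f) :=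
    e.hom.comm₂.trans (id_comp _)
  refine ⟨ObjectProperty.homMk (e₃.hom ≫ Q.map c), ?_, ?_⟩
  · rw [trW_iff_grHom]
    intro k U
    have h : HomotopyCategory.quasiIso AddCommGrpCat.{v} (.up ℤ)
        (((grHom B k U).mapHomotopyCategory (.up ℤ)).map (Q.map c)) :=
      (HomotopyCategory.quotient_map_mem_quasiIso_iff _).2 (quasiIso_grHom_toX₃ hS k U)
    have h' := (MorphismProperty.cancel_left_of_respectsIso _
      (((grHom B k U).mapHomotopyCategory (.up ℤ)).map e₃.hom) _).2 h
    rwa [← Functor.map_comp] at h'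
  · ext
    have h : Q.map (CochainComplex.mappingCone.inr (singleShortComplex S).f) ≫ Q.map c =
        Q.map (singleShortComplex S).g := by
      rw [← Functor.map_comp, CochainComplex.mappingCone.inr_toX₃]
    exact (assoc _ _ _).symm.trans ((congr_arg (· ≫ Q.map c) he).trans h)

lemma DerivedBounded.exists_distinguished {S : ShortComplex (FilteredObject B)}
    (hS : exactStructure B S) :
    ∃ δ, Triangle.mk (ofFiltered.map S.f) (ofFiltered.map S.g) δ ∈
      distTriang (DerivedBounded B) := by
  obtain ⟨Z, g, δ, hT⟩ := distinguished_cocone_triangle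
    (boundedMap ((CochainComplex.singleFunctor _ 0).map S.f)
      (single_bounded 0 S.X₁) (single_bounded 0 S.X₂))
  obtain ⟨z, hz, hgz⟩ := exists_trW_comp_eq hS hT
  let Q := BoundedDerivedCategory.Qh (exactStructure B)
  have : IsIso (Q.map z) := Localization.inverts Q
    (acyclicBounded (exactStructure B)).triangEnvelope.trW _ hz
  have h := mk_comp_mem_distTriang (Q.map_distinguished _ hT) (Q.map z) this
  have hg : Q.map g ≫ Q.map z = ofFiltered.map S.g := by
    rw [← Functor.map_comp, hgz]
    rfl
  exact ⟨_, (congr_arg (fun a => Triangle.mk (ofFiltered.map S.f) a _ ∈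
    distTriang (DerivedBounded B)) hg).mp h⟩

end FilteredObject

/-! ### Dimension shifting along a triangulated functor -/

section

variable {C D : Type*} [Category* C] [Category* D] (F : C ⥤ D)

lemma CategoryTheory.comp_eq_zero_of_conj [HasZeroMorphisms D] {P Q R S T T' : D} {m : P ⟶ Q}
    {e : P ≅ R} {e' : Q ≅ S} {r : R ⟶ S} (h : m ≫ e'.hom = e.hom ≫ r) (e'' : T ≅ T') {f : Q ⟶ T}
    (hf : r ≫ e'.inv ≫ f ≫ e''.hom = 0) : m ≫ f = 0 := by
  rw [← cancel_mono e''.hom, zero_comp, assoc, ← e'.hom_inv_id_assoc (f ≫ e''.hom),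
    reassoc_of% h, hf, comp_zero]

lemma CategoryTheory.Functor.bijective_map_of_iso {X Y Z : C} (e : Y ≅ Z)
    (h : Function.Bijective (F.map : (X ⟶ Y) → _)) :
    Function.Bijective (F.map : (X ⟶ Z) → _) := by
  refine ⟨fun f g hfg => ?_, fun f => ?_⟩
  · rw [← cancel_mono e.inv]
    exact h.1 (by simp [hfg])
  · obtain ⟨g, hg⟩ := h.2 (f ≫ F.map e.inv)
    exact ⟨g ≫ e.hom, by simp [hg]⟩

variable [HasShift C ℤ] [HasShift D ℤ] [F.CommShift ℤ]

lemma CategoryTheory.Functor.bijective_map_shift {X Y : C} (n : ℤ)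
    (h : Function.Bijective (F.map : (X ⟶ Y) → _)) :
    Function.Bijective (F.map : (X⟦n⟧ ⟶ Y⟦n⟧) → _) := by
  refine ⟨fun f g hfg => ?_, fun f => ?_⟩
  · obtain ⟨f, rfl⟩ := (shiftFunctor C n).map_surjective f
    obtain ⟨g, rfl⟩ := (shiftFunctor C n).map_surjective g
    congr 1
    apply h.1
    apply (shiftFunctor D n).map_injective
    have h₁ := (F.commShiftIso n).hom.naturality f
    have h₂ := (F.commShiftIso n).hom.naturality g
    dsimp at h₁ h₂
    rw [← cancel_epi ((F.commShiftIso n).hom.app X), ← h₁, ← h₂, hfg]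
  · obtain ⟨g, hg⟩ := (shiftFunctor D n).map_surjective
      ((F.commShiftIso n).inv.app X ≫ f ≫ (F.commShiftIso n).hom.app Y)
    obtain ⟨g, rfl⟩ := h.2 g
    refine ⟨g⟦n⟧', ?_⟩
    have h₁ := (F.commShiftIso n).hom.naturality g
    dsimp at h₁
    rw [← cancel_mono ((F.commShiftIso n).hom.app Y), h₁, hg]
    simp

lemma CategoryTheory.Functor.bijective_map_shift_add {X Y : C} {n m k : ℤ} (hk : m + n = k)
    (h : Function.Bijective (F.map : (X ⟶ Y⟦m⟧) → _)) :
    Function.Bijective (F.map : (X⟦n⟧ ⟶ Y⟦k⟧) → _) :=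
  F.bijective_map_of_iso ((shiftFunctorAdd' C m n k hk).symm.app Y) (F.bijective_map_shift n h)

variable [HasZeroObject C] [HasZeroObject D] [Preadditive C] [Preadditive D]
  [∀ n : ℤ, (shiftFunctor C n).Additive] [∀ n : ℤ, (shiftFunctor D n).Additive]
  [Pretriangulated C] [Pretriangulated D] [F.IsTriangulated]
  {K E X Y : C} {k : K ⟶ E} {p : E ⟶ X} {δ : X ⟶ K⟦(1 : ℤ)⟧}

/-- If `F` kills `δ ≫ g`, then `F g` extends along `F (-k[1])` to a morphism out of `F (E[1])`.
Nothing is assumed about morphisms out of `E[1]` itself, but `F` does not distinguish `E` from `E'`,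
so the extension lifts to `E'[1]`. By injectivity `g` factors through `k[1]`, and `δ ≫ k[1] = 0`. -/
lemma CategoryTheory.Functor.comp_eq_zero_of_map_comp_eq_zero
    (hT : Triangle.mk k p δ ∈ distTriang C) {E' : C} (c : E ⟶ E') [IsIso (F.map c)]
    (hK : Function.Injective (F.map : (K⟦(1 : ℤ)⟧ ⟶ Y) → _))
    (hE' : Function.Surjective (F.map : (E'⟦(1 : ℤ)⟧ ⟶ Y) → _))
    {g : K⟦(1 : ℤ)⟧ ⟶ Y} (hg : F.map (δ ≫ g) = 0) : δ ≫ g = 0 := by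
  obtain ⟨h, hh⟩ : ∃ h : F.obj (E⟦(1 : ℤ)⟧) ⟶ F.obj Y, F.map g = F.map (-k⟦(1 : ℤ)⟧') ≫ h :=
    Triangle.yoneda_exact₂ _ (F.map_distinguished _ (rot_of_distTriang _
      (rot_of_distTriang _ hT))) (F.map g) ((F.map_comp _ _).symm.trans hg)
  have : IsIso (F.map (c⟦(1 : ℤ)⟧')) :=
    (NatIso.isIso_map_iff (F.commShiftIso (1 : ℤ)) _).2
      (inferInstanceAs (IsIso ((F.map c)⟦(1 : ℤ)⟧')))
  obtain ⟨l, hl⟩ := hE' (CategoryTheory.inv (F.map (c⟦(1 : ℤ)⟧')) ≫ h)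
  obtain rfl : g = (-k⟦(1 : ℤ)⟧') ≫ c⟦(1 : ℤ)⟧' ≫ l := by
    apply hK
    refine hh.trans (Eq.symm ?_)
    rw [Functor.map_comp, Functor.map_comp, hl, IsIso.hom_inv_id_assoc]
  have hz : δ ≫ k⟦(1 : ℤ)⟧' = 0 := comp_distTriang_mor_zero₃₁ _ hT
  rw [Preadditive.neg_comp, Preadditive.comp_neg, reassoc_of% hz, zero_comp, neg_zero]

/-- A morphism killed by `F p` factors through `F δ`, and the other factor is lifted by hypothesis.
-/
lemma CategoryTheory.Functor.exists_map_eq_of_map_comp_eq_zero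
    (hT : Triangle.mk k p δ ∈ distTriang C)
    (hK : Function.Surjective (F.map : (K⟦(1 : ℤ)⟧ ⟶ Y) → _))
    {f : F.obj X ⟶ F.obj Y} (hf : F.map p ≫ f = 0) : ∃ g, F.map g = f := by
  obtain ⟨h, hh⟩ := Triangle.yoneda_exact₂ _ (F.map_distinguished _ (rot_of_distTriang _ hT)) f hf
  obtain ⟨g, rfl⟩ := hK h
  exact ⟨δ ≫ g, (F.map_comp _ _).trans hh.symm⟩

end

/-! ### Vanishing and comparison, by induction on the degree -/

namespace FilteredObject

variable {B : Type u} [Category.{v} B] [Abelian B]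

lemma eq_zero_of_single {i j : ℤ} (hij : j < i) {V V' : B} (f : single i V ⟶ single j V') :
    f = 0 := by
  have h := f.factors (-i)
  rw [single_W_of_le _ le_rfl, single_W_of_lt _ (by lia), Subobject.bot_factors_iff_zero] at h
  ext
  exact (cancel_epi (⊤ : Subobject V).arrow).1 (h.trans comp_zero.symm)

namespace DerivedBounded

lemma exists_extension {i : ℤ} {V : B} {Y : FilteredObject B} {n : ℤ} (hn : 0 < n)
    (f : of i V ⟶ (ofFiltered.obj Y)⟦n⟧) :
    ∃ (E : B) (p : E ⟶ V) (_ : Epi p) (δ : of i V ⟶ (of (i + 1) (kernel p))⟦(1 : ℤ)⟧)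
      (_ : Triangle.mk (ofFiltered.map (extensionIncl i p)) (ofFiltered.map (extensionProj i p)) δ ∈
        distTriang (DerivedBounded B)) (g : (of (i + 1) (kernel p))⟦(1 : ℤ)⟧ ⟶ _), f = δ ≫ g := by
  obtain ⟨E, p, hp, h⟩ := exists_epi_comp_eq_zero hn f
  obtain ⟨δ, hδ⟩ := exists_distinguished (extension_exact i p)
  obtain ⟨g, hg⟩ := Triangle.yoneda_exact₃ _ hδ f h
  exact ⟨E, p, hp, δ, hδ, g, hg⟩

/-- In degree `n + 1` a morphism factors through `(ker p){i + 1}[1]`, and `j - i < n + 1` gives `j -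
(i + 1) < n`; hence `i` and `V` must vary in the induction. -/
lemma subsingleton_hom (V V' : B) (i j n : ℤ) (hn : j - i < n) :
    Subsingleton (of i V ⟶ (of j V')⟦n⟧) := by
  suffices ∀ f : of i V ⟶ (of j V')⟦n⟧, f = 0 from ⟨fun f g => (this f).trans (this g).symm⟩
  obtain hn' | hn' := lt_or_ge n 0
  · exact hom_shift_eq_zero hn'
  obtain ⟨n, rfl⟩ := Int.eq_ofNat_of_zero_le hn'
  clear hn'
  induction n generalizing i V with
  | zero =>
    intro f
    -- In degree `0` the morphism comes from `FB`, and there is no nonzero filtered morphism `V{i} ⟶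
    -- V'{j}` when `j < i`.
    obtain ⟨g, hg⟩ := ofFiltered.map_surjective (f ≫ (shiftFunctorZero _ ℤ).hom.app _)
    rw [eq_zero_of_single (by lia) g, Functor.map_zero] at hg
    exact (cancel_mono ((shiftFunctorZero _ ℤ).hom.app (of j V'))).1 (hg.symm.trans zero_comp.symm)
  | succ n ih =>
    intro f
    obtain ⟨E, p, _, δ, hδ, g, rfl⟩ := exists_extension (by positivity) f
    obtain ⟨g', rfl⟩ : ∃ g', g = g'⟦1⟧' ≫ (shiftFunctorAdd' _ (n : ℤ) 1 (n + 1 : ℕ)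
        (by simp)).inv.app _ := by
      obtain ⟨g', hg'⟩ := (shiftFunctor _ (1 : ℤ)).map_surjective
        (g ≫ (shiftFunctorAdd' _ (n : ℤ) 1 (n + 1 : ℕ) (by simp)).hom.app _)
      exact ⟨g', by simp [hg']⟩
    obtain rfl : g' = 0 := ih _ _ (by push_cast at hn; lia) g'
    exact (congr_arg (fun x => δ ≫ x ≫ _) (Functor.map_zero _ _ _)).trans
      ((congr_arg (δ ≫ ·) zero_comp).trans comp_zero)

variable [HasDerivedCategory.{w} B]

instance : (AbelianDerivedBounded.single B).Faithful :=
  Functor.Faithful.of_comp_iso (H := DerivedCategory.singleFunctor B 0)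
    (ObjectProperty.liftCompιIso _ _ _)

instance : (AbelianDerivedBounded.single B).Full :=
  Functor.Full.of_comp_faithful_iso (H := DerivedCategory.singleFunctor B 0)
    (ObjectProperty.liftCompιIso _ _ _)

/-- On `FB`, the functor `Φ` is thus the forgetful functor followed by `B ⥤ D^b(B)`. Both are
faithful, which makes `FB ⥤ D^b(FB)` faithful. -/
lemma forgetDerivedSingleIso_naturality {X Y : FilteredObject B} (f : X ⟶ Y) :
    (forgetDerived B).map (ofFiltered.map f) ≫ (forgetDerivedSingleIso B Y).hom =
      (forgetDerivedSingleIso B X).hom ≫ (AbelianDerivedBounded.single B).map f.f := by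
  have h := (forgetDerivedFactors B).hom.naturality
    ((boundedHomotopySingle (FilteredObject B)).map f)
  refine Eq.trans (assoc _ _ _).symm ((congr_arg (· ≫ _) h).trans (Eq.trans (assoc _ _ _) ?_))
  refine (congr_arg _ ?_).trans (assoc _ _ _).symm
  apply (DerivedCategory.TStructure.t (C := B)).bounded.ι.map_injective
  have h' := (HomologicalComplex.singleMapHomologicalComplex (forget B) (.up ℤ) 0).hom.naturality f
  let G := HomotopyCategory.quotient B (.up ℤ) ⋙ DerivedCategory.Qh
  exact (G.map_comp _ _).symm.trans ((congr_arg G.map h').trans (G.map_comp _ _))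

instance : (ofFiltered (B := B)).Faithful where
  map_injective {X Y f g} h := by
    ext
    apply (AbelianDerivedBounded.single B).map_injective
    rw [← cancel_epi (forgetDerivedSingleIso B X).hom, ← forgetDerivedSingleIso_naturality,
      ← forgetDerivedSingleIso_naturality, h]

/-- Needed for `extensionToSingle`, whose underlying morphism is an identity although the
filtrations may differ. -/
instance isIso_map_of_isIso {X Y : FilteredObject B} (f : X ⟶ Y) [IsIso f.f] :
    IsIso ((forgetDerived B).map (ofFiltered.map f)) := by
  rw [← isIso_comp_right_iff _ (forgetDerivedSingleIso B Y).hom,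
    forgetDerivedSingleIso_naturality]
  infer_instance

/-- Since `-j ≤ -i`, the step `W (-i)` of `V'{j}` is everything, so each morphism `V ⟶ V'` is
filtered. -/
lemma bijective_map_zero (V V' : B) {i j : ℤ} (hij : i ≤ j) :
    Function.Bijective ((forgetDerived B).map : (of i V ⟶ of j V') → _) := by
  let eX := forgetDerivedSingleIso B (single i V)
  let eY := forgetDerivedSingleIso B (single j V')
  refine ⟨fun f g hfg => ?_, fun f => ?_⟩
  · obtain ⟨f, rfl⟩ := ofFiltered.map_surjective f
    obtain ⟨g, rfl⟩ := ofFiltered.map_surjective g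
    congr 1
    ext
    apply (AbelianDerivedBounded.single B).map_injective
    refine (cancel_epi eX.hom).1 ?_
    exact (forgetDerivedSingleIso_naturality f).symm.trans
      ((congr_arg (· ≫ eY.hom) hfg).trans (forgetDerivedSingleIso_naturality g))
  · obtain ⟨g, hg⟩ := (AbelianDerivedBounded.single B).map_surjective (eX.inv ≫ f ≫ eY.hom)
    let h : single i V ⟶ single j V' := homOfSingle (X := single j V') g
      (factors_of_W_eq_top (single_W_of_le V' (by lia)) g)
    refine ⟨ofFiltered.map h, (cancel_mono eY.hom).1 ?_⟩
    refine (forgetDerivedSingleIso_naturality h).trans ?_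
    refine (congr_arg (eX.hom ≫ ·) hg).trans ?_
    rw [eX.hom_inv_id_assoc]
    rfl

lemma bijective_map (V V' : B) (i j n : ℤ) (hn : n ≤ j - i) :
    Function.Bijective ((forgetDerived B).map : (of i V ⟶ (of j V')⟦n⟧) → _) := by
  obtain hn' | hn' := lt_or_ge n 0
  · let eY := ((forgetDerived B).commShiftIso n).app (of j V') ≪≫
      (shiftFunctor _ n).mapIso (forgetDerivedSingleIso B (single j V'))
    refine ⟨fun f g _ => (hom_shift_eq_zero hn' f).trans (hom_shift_eq_zero hn' g).symm,
      fun f => ⟨0, ?_⟩⟩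
    have h := AbelianDerivedBounded.hom_shift_eq_zero hn'
      ((forgetDerivedSingleIso B (single i V)).inv ≫ f ≫ eY.hom)
    rw [Functor.map_zero]
    exact ((cancel_mono eY.hom).1 ((Iso.inv_comp_eq _).1 h |>.trans
      (comp_zero.trans zero_comp.symm))).symm
  obtain ⟨n, rfl⟩ := Int.eq_ofNat_of_zero_le hn'
  clear hn'
  induction n generalizing i V with
  | zero =>
    exact (forgetDerived B).bijective_map_of_iso ((shiftFunctorZero _ ℤ).symm.app _)
      (bijective_map_zero V V' (by lia))
  | succ n ih =>
    -- Degree `n` for `W{i + 1}`, shifted by one; the bound `n + 1 ≤ j - i` is the same as `n ≤ j -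
    -- (i + 1)`.
    replace ih (W : B) : Function.Bijective ((forgetDerived B).map :
        ((of (i + 1) W)⟦(1 : ℤ)⟧ ⟶ (of j V')⟦((n + 1 : ℕ) : ℤ)⟧) → _) :=
      (forgetDerived B).bijective_map_shift_add (by push_cast; rfl)
        (ih W (i + 1) (by push_cast at hn; lia))
    refine ⟨(injective_iff_map_eq_zero ((forgetDerived B).mapAddHom (X := of i V)
      (Y := (of j V')⟦((n + 1 : ℕ) : ℤ)⟧))).2 fun f hf => ?_, fun f => ?_⟩
    · obtain ⟨E, p, _, δ, hδ, g, rfl⟩ := exists_extension (by positivity) f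
      have : IsIso (extensionToSingle i p).f := inferInstanceAs (IsIso (𝟙 _))
      -- The induction hypothesis is used twice: injectivity for `(ker p){i + 1}` and surjectivity
      -- for `E{i + 1}`, the latter replacing the filtered extension.
      exact (forgetDerived B).comp_eq_zero_of_map_comp_eq_zero hδ
        (ofFiltered.map (extensionToSingle i p)) (ih _).1 (ih E).2 hf
    · let eY := ((forgetDerived B).commShiftIso ((n + 1 : ℕ) : ℤ)).app (of j V') ≪≫
        (shiftFunctor _ ((n + 1 : ℕ) : ℤ)).mapIso (forgetDerivedSingleIso B (single j V'))
      -- For surjectivity the epimorphism is chosen in `D^b(B)`, and the resulting exact sequence of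
      -- `B` is then given its two-step filtration.
      obtain ⟨E, p, _, h⟩ := AbelianDerivedBounded.exists_epi_comp_eq_zero (by positivity)
        ((forgetDerivedSingleIso B (single i V)).inv ≫ f ≫ eY.hom)
      obtain ⟨δ, hδ⟩ := exists_distinguished (extension_exact i p)
      refine (forgetDerived B).exists_map_eq_of_map_comp_eq_zero hδ (ih _).2 ?_
      exact comp_eq_zero_of_conj (forgetDerivedSingleIso_naturality (extensionProj i p)) eY h

end DerivedBounded

end FilteredObject

theorem mainTheorem9 {A : Type t} [CommRing A] {B : Type u} [Category.{v} B] [Abelian B]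
    [Linear A B] [HasDerivedCategory.{w} B] (V V' : B) (i j n : ℤ) :
    (n ≤ j - i →
      ∃ e : (FilteredObject.DerivedBounded.of i V ⟶
            (FilteredObject.DerivedBounded.of j V')⟦n⟧) ≃ₗ[A]
          ((AbelianDerivedBounded.single B).obj V ⟶
            ((AbelianDerivedBounded.single B).obj V')⟦n⟧),
        ∀ f, e f =
          (FilteredObject.forgetDerivedSingleIso B (FilteredObject.single i V)).inv ≫
            (FilteredObject.forgetDerived B).map f ≫
            ((FilteredObject.forgetDerived B).commShiftIso n).hom.app _ ≫
            (FilteredObject.forgetDerivedSingleIso B (FilteredObject.single j V')).hom⟦n⟧') ∧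
    (j - i < n →
      Subsingleton (FilteredObject.DerivedBounded.of i V ⟶
        (FilteredObject.DerivedBounded.of j V')⟦n⟧)) := by
  exact ⟨fun hn => FilteredObject.exists_linearEquiv_of_bijective V V' i j n
    (FilteredObject.DerivedBounded.bijective_map V V' i j n hn),
    fun hn => FilteredObject.DerivedBounded.subsingleton_hom V V' i j n hn⟩
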